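/- Let $g>0$ and let $h=-\frac{d^2}{dx^2}+g\,\delta(x)$ be the operator in $L^2((-\frac12,\frac12))$ with periodic boundary conditions associated with the quadratic form $q(f)=\int_{-1/2}^{1/2}|f'|^2dx+g|f(0)|^2$ on the periodic Sobolev space $H^1$. Let $p=-i\,d/dx$ with domain the periodic $H^1$, let $\langle\cdot,\cdot\rangle$ be linear in the first variable, and let $e^{ith}$ be the strongly continuous unitary group generated by $ih$ (it exists and is unique). 1. The equation $\beta\tan(\beta/2)=g/2$ has exactly one solution $\beta_1\in(0,2\pi)$, and there is $C_1>0$ such that $$\tilde u_1(x)=C_1\Big\{\cos(\beta_1x)+\frac{g}{2\beta_1}\sin(\beta_1|x|)\Big\}$$ is a normalized, non-degenerate ground state of $h$, with eigenvalue $\lambda_1=\beta_1^2$. The functions $u_j(x)=\sqrt2\sin(2\pi jx)$, $j\ge1$, are normalized odd eigenfunctions of $h$ with eigenvalues $4\pi^2j^2$, and every odd eigenfunction is a multiple of one of them. 2. The momentum matrix elements $\hat\pi_j:=\langle\tilde u_1,p\,u_j\rangle=i\langle\tilde u_1,u_j'\rangle$ decay only like $1/j$: $$\hat\pi_j=-\,i\,\frac{C_1g}{\sqrt2\,j\pi}+\mathcal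 O(1/j^3),\qquad j\to\infty .$$ 3. For all $t\in\mathbb R$ we have $e^{ith}\tilde u_1\in\mathrm{dom}(p)$, and there are a real constant $K\neq0$ and a function $F:\mathbb R\to\mathbb R$, differentiable at $0$, such that in the sense of quadratic forms (that is, $\langle[A,B]u,u\rangle:=\langle Bu,Au\rangle-\langle Au,Bu\rangle$) $$i\langle[p,e^{ith}pe^{-ith}]\tilde u_1,\tilde u_1\rangle=K\sum_{j\ge1}\frac{\sin(4\pi^2j^2t)}{j^2}+F(t),\qquad t\in\mathbb R .$$ Neither the Riemann function $t\mapsto\sum_{j\ge1}\sin(4\pi^2j^2t)/j^2$ nor the left-hand side is differentiable at $t=0$. The left-hand side is nevertheless Hölder continuous at $t=0$ of every order $\alpha\in[0,\frac12)$. 4. The sum rule $\langle[p,[h,p]]\tilde u_1,\tilde u_1\rangle=2\sum_n|\langle p\tilde u_1,e_n\rangle|^2(E_n-\lambda_1)$ fails: $h$ has an orthonormal basis of eigenfunctions, and for every orthonormal basis $(e_n)_{n\in\mathbb N}$ of eigenfunctions, $he_n=E_ne_n$, the series on the right does not converge (as an unconditional sum) to any real number. -/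

import Mathlib

open MeasureTheory Set Filter Topology
open scoped Asymptotics

namespace PeriodicDelta

noncomputable section

/-- Lebesgue measure on the unit cell `(-1/2, 1/2)`. -/
abbrev cellMeasure : Measure ℝ := volume.restrict (Ioo (-1 / 2 : ℝ) (1 / 2))

/-- The Hilbert space `L²((-1/2, 1/2); ℂ)`. -/
abbrev L2 : Type := Lp ℂ 2 cellMeasure

theorem memLp_of_continuous {u : ℝ → ℂ} (hu : Continuous u) : MemLp u 2 cellMeasure := by
  have h : MemLp u 2 (volume.restrict (Icc (-1 / 2 : ℝ) (1 / 2))) := by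
    obtain ⟨K, hK⟩ := (isCompact_Icc (a := (-1 / 2 : ℝ)) (b := 1 / 2)).exists_bound_of_continuousOn
      hu.continuousOn
    refine MemLp.of_bound hu.aestronglyMeasurable K ?_
    exact (ae_restrict_iff' measurableSet_Icc).2 (Eventually.of_forall hK)
  exact h.mono_measure (Measure.restrict_mono Ioo_subset_Icc_self le_rfl)

/-- `f` belongs to the periodic Sobolev space `H¹`, with weak derivative `v` and with `u` as its
continuous representative on `[-1/2, 1/2]`: `u` is the primitive of the square integrable
function `v` and takes the same value at the two (identified) endpoints. -/
def IsPeriodicH1 (u : ℝ → ℂ) (f v : L2) : Prop :=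
  f =ᵐ[cellMeasure] u ∧
  (∀ x ∈ Icc (-1 / 2 : ℝ) (1 / 2), u x = u (-1 / 2) + ∫ y in (-1 / 2 : ℝ)..x, v y) ∧
  u (1 / 2) = u (-1 / 2)

theorem intervalIntegrable_coe (v : L2) {x : ℝ} (hx : x ∈ Icc (-1 / 2 : ℝ) (1 / 2)) :
    IntervalIntegrable v volume (-1 / 2) x := by
  have h1 : Integrable v cellMeasure := (Lp.memLp v).integrable (by norm_num)
  have h2 : IntegrableOn v (Ioc (-1 / 2 : ℝ) (1 / 2)) volume := by
    rw [integrableOn_Ioc_iff_integrableOn_Ioo]; exact h1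
  rw [intervalIntegrable_iff_integrableOn_Ioc_of_le hx.1]
  exact h2.mono_set (Ioc_subset_Ioc_right hx.2)

theorem intervalIntegral_congr_cell {v w : ℝ → ℂ} (h : v =ᵐ[cellMeasure] w) {x : ℝ}
    (hx : x ∈ Icc (-1 / 2 : ℝ) (1 / 2)) :
    ∫ y in (-1 / 2 : ℝ)..x, v y = ∫ y in (-1 / 2 : ℝ)..x, w y := by
  rw [intervalIntegral.integral_of_le hx.1, intervalIntegral.integral_of_le hx.1,
    integral_Ioc_eq_integral_Ioo, integral_Ioc_eq_integral_Ioo]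
  exact integral_congr_ae
    (ae_mono (Measure.restrict_mono (Ioo_subset_Ioo_right hx.2) le_rfl) h)

theorem IsPeriodicH1.zero : IsPeriodicH1 0 0 0 := by
  refine ⟨Lp.coeFn_zero _ _ _, fun x hx => ?_, rfl⟩
  rw [intervalIntegral_congr_cell (Lp.coeFn_zero ℂ 2 cellMeasure) hx]
  simp

theorem IsPeriodicH1.add {u₁ u₂ : ℝ → ℂ} {f₁ f₂ v₁ v₂ : L2} (h₁ : IsPeriodicH1 u₁ f₁ v₁)
    (h₂ : IsPeriodicH1 u₂ f₂ v₂) : IsPeriodicH1 (u₁ + u₂) (f₁ + f₂) (v₁ + v₂) := by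
  refine ⟨(Lp.coeFn_add f₁ f₂).trans (h₁.1.add h₂.1), fun x hx => ?_, ?_⟩
  · rw [intervalIntegral_congr_cell (Lp.coeFn_add v₁ v₂) hx]
    simp only [Pi.add_apply]
    rw [intervalIntegral.integral_add (intervalIntegrable_coe v₁ hx)
      (intervalIntegrable_coe v₂ hx), h₁.2.1 x hx, h₂.2.1 x hx]
    ring
  · simp only [Pi.add_apply, h₁.2.2, h₂.2.2]

theorem IsPeriodicH1.smul {u : ℝ → ℂ} {f v : L2} (c : ℂ) (h : IsPeriodicH1 u f v) :
    IsPeriodicH1 (c • u) (c • f) (c • v) := by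
  refine ⟨(Lp.coeFn_smul c f).trans (h.1.const_smul c), fun x hx => ?_, ?_⟩
  · rw [intervalIntegral_congr_cell (Lp.coeFn_smul c v) hx]
    simp only [Pi.smul_apply, smul_eq_mul]
    rw [intervalIntegral.integral_const_mul, h.2.1 x hx]
    ring
  · simp only [Pi.smul_apply, h.2.2]

/-- The graph of the periodic momentum operator `-i d/dx`. -/
def momentumGraph : Submodule ℂ (L2 × L2) where
  carrier := {z | ∃ u v, IsPeriodicH1 u z.1 v ∧ z.2 = (-Complex.I) • v}
  zero_mem' := ⟨0, 0, IsPeriodicH1.zero, by simp⟩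
  add_mem' := by
    rintro ⟨f₁, w₁⟩ ⟨f₂, w₂⟩ ⟨u₁, v₁, h₁, e₁⟩ ⟨u₂, v₂, h₂, e₂⟩
    exact ⟨u₁ + u₂, v₁ + v₂, h₁.add h₂, by simp_all⟩
  smul_mem' := by
    rintro c ⟨f, w⟩ ⟨u, v, h, e⟩
    exact ⟨c • u, c • v, h.smul c, by simp only at e; simp [e, smul_comm c]⟩

/-- The graph of the operator associated with the quadratic form
`q(f) = ∫ |f'|² + g |f(0)|²` on the periodic Sobolev space `H¹`: the pair `(f, w)` is in the
graph when `f` is in the form domain and `q(φ, f) = ⟨φ, w⟩` for all `φ` in the form domain. -/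
def deltaGraph (g : ℝ) : Submodule ℂ (L2 × L2) where
  carrier := {z | ∃ u v, IsPeriodicH1 u z.1 v ∧ ∀ a φ η, IsPeriodicH1 a φ η →
    inner ℂ η v + g * (starRingEnd ℂ (a 0) * u 0) = inner ℂ φ z.2}
  zero_mem' := ⟨0, 0, IsPeriodicH1.zero, by intros; simp⟩
  add_mem' := by
    rintro ⟨f₁, w₁⟩ ⟨f₂, w₂⟩ ⟨u₁, v₁, h₁, e₁⟩ ⟨u₂, v₂, h₂, e₂⟩
    refine ⟨u₁ + u₂, v₁ + v₂, h₁.add h₂, fun a φ η h => ?_⟩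
    simp only [Prod.mk_add_mk, inner_add_right, Pi.add_apply]
    rw [← e₁ a φ η h, ← e₂ a φ η h]
    ring
  smul_mem' := by
    rintro c ⟨f, w⟩ ⟨u, v, h, e⟩
    refine ⟨c • u, c • v, h.smul c, fun a φ η h' => ?_⟩
    simp only [Prod.smul_mk, inner_smul_right, Pi.smul_apply, smul_eq_mul]
    rw [← e a φ η h']
    ring

/-- The element of `L²` given by a continuous function. -/
def ofContinuous (u : ℝ → ℂ) (hu : Continuous u) : L2 := (memLp_of_continuous hu).toLp u

theorem IsPeriodicH1.continuousOn {u : ℝ → ℂ} {f v : L2} (h : IsPeriodicH1 u f v) :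
    ContinuousOn u (Icc (-1 / 2 : ℝ) (1 / 2)) := by
  have h1 : IntegrableOn v (uIcc (-1 / 2 : ℝ) (1 / 2)) volume := by
    rw [uIcc_of_le (by norm_num), integrableOn_Icc_iff_integrableOn_Ioo]
    exact (Lp.memLp v).integrable (by norm_num)
  have h2 := intervalIntegral.continuousOn_primitive_interval h1
  rw [uIcc_of_le (by norm_num)] at h2
  exact (continuousOn_const.add h2).congr h.2.1

/-- The continuous representative and the weak derivative are determined by the function. -/
theorem IsPeriodicH1.eq_zero {u : ℝ → ℂ} {v : L2} (h : IsPeriodicH1 u 0 v) :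
    EqOn u 0 (Icc (-1 / 2 : ℝ) (1 / 2)) ∧ v = 0 := by
  have hu : EqOn u 0 (Icc (-1 / 2 : ℝ) (1 / 2)) := by
    refine Measure.eqOn_Icc_of_ae_eq volume (by norm_num) ?_ h.continuousOn continuousOn_const
    rw [← restrict_Ioo_eq_restrict_Icc]
    exact h.1.symm.trans (Lp.coeFn_zero ℂ 2 cellMeasure)
  refine ⟨hu, ?_⟩
  have hint : ∀ x ∈ Icc (-1 / 2 : ℝ) (1 / 2), ∫ y in (-1 / 2 : ℝ)..x, v y = 0 := by
    intro x hx
    have h1 := h.2.1 x hx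
    rw [hu hx, hu (show (-1 / 2 : ℝ) ∈ Icc (-1 / 2 : ℝ) (1 / 2) by norm_num)] at h1
    simpa using h1.symm
  rw [Lp.eq_zero_iff_ae_eq_zero]
  have hd := (intervalIntegrable_coe v (x := 1 / 2) (by norm_num)).ae_hasDerivAt_integral
  refine (ae_restrict_iff' measurableSet_Ioo).2 ?_
  filter_upwards [hd] with x hx hxI
  have h2 := hx (by rw [uIcc_of_le (by norm_num)]; exact Ioo_subset_Icc_self hxI) (-1 / 2)
    left_mem_uIcc
  have h3 : HasDerivAt (fun x => ∫ y in (-1 / 2 : ℝ)..x, v y) 0 x := by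
    refine (hasDerivAt_const x (0 : ℂ)).congr_of_eventuallyEq ?_
    filter_upwards [Ioo_mem_nhds hxI.1 hxI.2] with z hz
    exact hint z (Ioo_subset_Icc_self hz)
  exact h2.unique h3

theorem isPeriodicH1_of_hasDerivAt {u u' : ℝ → ℂ} (hu : ∀ x, HasDerivAt u (u' x) x)
    (hu' : Continuous u') (hp : u (1 / 2) = u (-1 / 2)) :
    IsPeriodicH1 u
      (ofContinuous u (continuous_iff_continuousAt.2 fun x => (hu x).continuousAt))
      (ofContinuous u' hu') := by
  refine ⟨MemLp.coeFn_toLp _, fun x hx => ?_, hp⟩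
  have h1 : (ofContinuous u' hu') =ᵐ[cellMeasure] u' := MemLp.coeFn_toLp _
  rw [intervalIntegral_congr_cell h1 hx,
    intervalIntegral.integral_eq_sub_of_hasDerivAt (fun y _ => hu y)
      (hu'.intervalIntegrable _ _)]
  ring

/-- `momentumGraph` is single-valued. -/
theorem momentumGraph_snd_eq_zero (z : L2 × L2) (hz : z ∈ momentumGraph) (h0 : z.1 = 0) :
    z.2 = 0 := by
  obtain ⟨u, v, h, e⟩ := hz
  rw [h0] at h
  rw [e, h.eq_zero.2, smul_zero]

/-- `deltaGraph g` is single-valued. -/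
theorem deltaGraph_snd_eq_zero (g : ℝ) (z : L2 × L2) (hz : z ∈ deltaGraph g) (h0 : z.1 = 0) :
    z.2 = 0 := by
  obtain ⟨u, v, h, e⟩ := hz
  rw [h0] at h
  have hu0 : u 0 = 0 := h.eq_zero.1 (show (0 : ℝ) ∈ Icc (-1 / 2 : ℝ) (1 / 2) by norm_num)
  rw [Lp.eq_zero_iff_ae_eq_zero]
  have hloc : LocallyIntegrableOn z.2 (Ioo (-1 / 2 : ℝ) (1 / 2)) volume :=
    IntegrableOn.locallyIntegrableOn ((Lp.memLp z.2).integrable (by norm_num))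
  refine (ae_restrict_iff' measurableSet_Ioo).2
    (isOpen_Ioo.ae_eq_zero_of_integral_contDiff_smul_eq_zero hloc fun a ha _ hs => ?_)
  have hout : ∀ x, x ∉ Ioo (-1 / 2 : ℝ) (1 / 2) → a x = 0 := fun x hx =>
    image_eq_zero_of_notMem_tsupport fun h => hx (hs h)
  have hda : ∀ x, HasDerivAt (fun y => (a y : ℂ)) ((deriv a x : ℝ) : ℂ) x := fun x =>
    ((ha.differentiable (by simp)) x).hasDerivAt.ofReal_comp
  have hca : Continuous fun x => ((deriv a x : ℝ) : ℂ) :=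
    Complex.continuous_ofReal.comp (ha.continuous_deriv (by simp))
  have h1 := e _ _ _ (isPeriodicH1_of_hasDerivAt hda hca
    (by rw [hout _ (by norm_num), hout _ (by norm_num)]))
  rw [h.eq_zero.2, hu0, inner_zero_right, mul_zero, mul_zero, add_zero] at h1
  rw [L2.inner_def] at h1
  rw [← setIntegral_eq_integral_of_forall_compl_eq_zero (s := Ioo (-1 / 2 : ℝ) (1 / 2))
    (fun x hx => by rw [hout x hx, zero_smul]), h1]
  refine integral_congr_ae ?_
  filter_upwards [MemLp.coeFn_toLp (memLp_of_continuous (continuous_iff_continuousAt.2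
    fun x => (hda x).continuousAt))] with x hx
  rw [ofContinuous, hx]
  simp [mul_comm]

/-- The momentum operator `p = -i d/dx` with periodic boundary conditions. -/
def momentum : L2 →ₗ.[ℂ] L2 := momentumGraph.toLinearPMap

/-- The operator `h = -d²/dx² + g δ(x)` with periodic boundary conditions. -/
def deltaHamiltonian (g : ℝ) : L2 →ₗ.[ℂ] L2 := (deltaGraph g).toLinearPMap

theorem momentum_graph : momentum.graph = momentumGraph :=
  Submodule.toLinearPMap_graph_eq _ momentumGraph_snd_eq_zero

theorem deltaHamiltonian_graph (g : ℝ) : (deltaHamiltonian g).graph = deltaGraph g :=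
  Submodule.toLinearPMap_graph_eq _ (deltaGraph_snd_eq_zero g)

/-- The value `A f` of an unbounded operator, with the junk value `0` off the domain of `A`. -/
def app (A : L2 →ₗ.[ℂ] L2) (f : L2) : L2 :=
  open scoped Classical in if hf : f ∈ A.domain then A ⟨f, hf⟩ else 0

/-- `f` is an eigenvector of `A` with eigenvalue `E`. -/
def IsEigenvector (A : L2 →ₗ.[ℂ] L2) (E : ℝ) (f : L2) : Prop :=
  f ≠ 0 ∧ (f, (E : ℂ) • f) ∈ A.graph

/-- `f` is an eigenvector of `A` whose eigenvalue `E` is the infimum of `⟨φ, A φ⟩` over the unit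
vectors `φ` in the domain of `A`. -/
def IsGroundState (A : L2 →ₗ.[ℂ] L2) (E : ℝ) (f : L2) : Prop :=
  IsEigenvector A E f ∧ ∀ φ : A.domain, E * ‖(φ : L2)‖ ^ 2 ≤ (inner ℂ (φ : L2) (A φ)).re

/-- `U t = exp (i t A)`: a strongly continuous one-parameter group of unitary operators whose
infinitesimal generator is exactly `i A`. -/
def IsUnitaryGroupOf (A : L2 →ₗ.[ℂ] L2) (U : ℝ → (L2 ≃ₗᵢ[ℂ] L2)) : Prop :=
  (∀ s t f, U (s + t) f = U s (U t f)) ∧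
  (∀ f, Continuous fun t => U t f) ∧
  (∀ f w, (f, w) ∈ A.graph ↔ HasDerivAt (fun t => U t f) (Complex.I • w) 0)

/-- The expectation `i ⟨[A, B] f, f⟩` with `B = U(t) A U(-t)`, in the sense of quadratic forms:
`i (⟨B f, A f⟩ - ⟨A f, B f⟩)`, with `⟨·, ·⟩` linear in the first variable, that is,
`⟨x, y⟩ = inner ℂ y x`. -/
def commutatorExpectation (A : L2 →ₗ.[ℂ] L2) (U : ℝ → (L2 ≃ₗᵢ[ℂ] L2)) (f : L2) (t : ℝ) : ℂ :=
  Complex.I * (inner ℂ (app A f) (U t (app A (U (-t) f)))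
    - inner ℂ (U t (app A (U (-t) f))) (app A f))

/-- The odd function `√2 sin (2 π j x)`. -/
def oddState (j : ℕ) : L2 :=
  ofContinuous (fun x => ((√2 * Real.sin (2 * Real.pi * j * x) : ℝ) : ℂ)) (by fun_prop)

/-- The even function `C (cos (β x) + (g / (2 β)) sin (β |x|))`. -/
def evenState (g β C : ℝ) : L2 :=
  ofContinuous
    (fun x => ((C * (Real.cos (β * x) + g / (2 * β) * Real.sin (β * |x|)) : ℝ) : ℂ))
    (by fun_prop)

/-- `f(-x) = -f(x)` for almost every `x`. -/
def IsOdd (f : L2) : Prop := ∀ᵐ x ∂cellMeasure, f (-x) = -f x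

/-- The Riemann function `∑_{j ≥ 1} sin (4 π² j² t) / j²`. -/
def riemannFunction (t : ℝ) : ℝ :=
  ∑' j : ℕ, Real.sin (4 * Real.pi ^ 2 * (j + 1 : ℝ) ^ 2 * t) / (j + 1 : ℝ) ^ 2

end

end PeriodicDelta

open PeriodicDelta

/-! Everything rests on the fact that the delta function is flat in Fourier space. Testing the form
against plane waves shows that an eigenfunction with eigenvalue `E` has Fourier coefficients `c n`
with `(E - 4π²n²) c n` independent of `n` (`exists_inner_wave_eigenvector`). For the even state this
gives coefficients `gC / (β² - 4π²n²)`, hence non-degeneracy. An eigenfunction with `0 < E < β²`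
would have to be orthogonal to the even state, yet the Parseval series of that inner product has all
its terms positive up to a common nonzero factor (`sq_le_of_eigenvector`).

The operator theory goes through the resolvent at `-1`: the free resolvent is a norm convergent sum
of rank-one operators, and the delta interaction subtracts one more rank-one term built from the
Green function (`exists_resolvent`). It is compact and symmetric, so there is an eigenbasis; in it
the graph of the Hamiltonian is coefficientwise multiplication (`mem_deltaGraph_iff`), and the
unitary group is multiplication by phases.

The momentum image `P` of the ground state is odd, with sine coefficients of order `1/j`. Since the
ground state only acquires a phase, the commutator expectation is `-2 ∑ |⟨u_j, P⟩|² sin ((4π²j² -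
β²) t)` (`hasSum_commutatorExpectation`). The weights are `κ / j² + O(1/j⁴)`. The addition formula
removes the frequency shift, leaving `-2κ` times the Riemann function plus a remainder
differentiable at `0` (`exists_differentiableAt_remainder`).

If the Riemann function were differentiable at `0`, its primitive vanishing at `0` would be `O(t²)`;
but at `t = 1/(4π²N²)` the first `N` nonnegative terms already contribute `8Nt²`
(`not_differentiableAt_riemannFunction`). Hölder continuity follows from `|sin x| ≤ |x|^α` and the
convergence of `∑ j^(2α-2)`.

The sum rule fails for the same reason: the commutator has the analogous sine series in any
eigenbasis, and convergence of the sum rule is summability of the termwise derivatives at `0`, which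
would make the commutator differentiable (`differentiable_tsum_sin`). -/

namespace PeriodicDelta

/-! ### Integration by parts for Sobolev functions -/

/-- A complex primitive of an integrable function is absolutely continuous. -/
theorem absolutelyContinuousOnInterval_intervalIntegral {η : ℝ → ℂ} {a b : ℝ}
    (h : IntervalIntegrable η volume a b) :
    AbsolutelyContinuousOnInterval (fun x => ∫ y in a..x, η y) a b := by
  have hre : IntervalIntegrable (fun x => (η x).re) volume a b :=
    ⟨h.1.re, h.2.re⟩
  have him : IntervalIntegrable (fun x => (η x).im) volume a b :=
    ⟨h.1.im, h.2.im⟩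
  have hc : ∀ c : ℂ, AbsolutelyContinuousOnInterval (fun _ : ℝ => c) a b := fun c =>
    ContDiffOn.absolutelyContinuousOnInterval contDiffOn_const
  have h1 : AbsolutelyContinuousOnInterval (fun x =>
      (∫ y in a..x, (η y).re) • (1 : ℂ) + (∫ y in a..x, (η y).im) • Complex.I) a b :=
    ((hre.absolutelyContinuousOnInterval_intervalIntegral
      (c := a) left_mem_uIcc).fun_smul (hc 1)).fun_add
      ((him.absolutelyContinuousOnInterval_intervalIntegral (c := a) left_mem_uIcc).fun_smul
        (hc Complex.I))
  unfold AbsolutelyContinuousOnInterval at h1 ⊢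
  refine h1.congr' ?_
  -- Absolute continuity only sees families of intervals inside `uIcc a b`, so it is enough that the
  -- recombined real and imaginary primitives agree with the complex one there.
  filter_upwards [mem_inf_of_right (mem_principal_self _)] with I hI
  refine Finset.sum_congr rfl fun i hi => ?_
  have key : ∀ x ∈ uIcc a b, (∫ y in a..x, (η y).re) • (1 : ℂ)
      + (∫ y in a..x, (η y).im) • Complex.I = ∫ y in a..x, η y := by
    intro x hx
    have hi : IntervalIntegrable η volume a x := h.mono_set (uIcc_subset_uIcc_left hx)
    have e1 : (∫ y in a..x, η y).re = ∫ y in a..x, (η y).re := by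
      exact (Complex.reCLM.intervalIntegral_comp_comm hi).symm
    have e2 : (∫ y in a..x, η y).im = ∫ y in a..x, (η y).im := by
      exact (Complex.imCLM.intervalIntegral_comp_comm hi).symm
    simp only [Complex.real_smul, mul_one]
    rw [← e1, ← e2, Complex.re_add_im]
  rw [key _ (hI.1 i hi).1, key _ (hI.1 i hi).2]

/-- Integration by parts against a continuously differentiable function. -/
theorem integral_deriv_mul_add {η A w w' : ℝ → ℂ} {a b : ℝ}
    (h : IntervalIntegrable η volume a b)
    (hA : ∀ x ∈ uIcc a b, A x = A a + ∫ y in a..x, η y)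
    (hw : ∀ x, HasDerivAt w (w' x) x) (hw' : Continuous w') :
    ∫ x in a..b, (η x * w x + A x * w' x) = A b * w b - A a * w a := by
  -- `A` is a primitive only on the interval; `B` is one everywhere, so its derivative can be taken
  -- without restricting to the interval.
  set B : ℝ → ℂ := fun x => A a + ∫ y in a..x, η y with hB
  have hwc : Continuous w := continuous_iff_continuousAt.2 fun x => (hw x).continuousAt
  have hc : AbsolutelyContinuousOnInterval (fun _ : ℝ => A a) a b :=
    ContDiffOn.absolutelyContinuousOnInterval contDiffOn_const
  have hBac : AbsolutelyContinuousOnInterval B a b :=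
    hc.add (absolutelyContinuousOnInterval_intervalIntegral h)
  have hwac : AbsolutelyContinuousOnInterval w a b := by
    refine ContDiffOn.absolutelyContinuousOnInterval (ContDiff.contDiffOn ?_)
    rw [contDiff_one_iff_deriv]
    refine ⟨fun x => (hw x).differentiableAt, ?_⟩
    rwa [show deriv w = w' from funext fun x => (hw x).deriv]
  have hi : IntervalIntegrable (fun x => η x * w x + B x * w' x) volume a b :=
    (h.mul_continuousOn hwc.continuousOn).add
      ((hBac.continuousOn.mul hw'.continuousOn).intervalIntegrable)
  -- The product minus the primitive of its formal derivative is absolutely continuous with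
  -- derivative zero almost everywhere, hence constant.
  obtain ⟨C, hC⟩ := ((hBac.smul hwac).sub
    (absolutelyContinuousOnInterval_intervalIntegral hi)).const_of_ae_hasDerivAt_zero (by
      filter_upwards [h.ae_hasDerivAt_integral, hi.ae_hasDerivAt_integral] with x h1 h2 hx
      have h3 := (((h1 hx a left_mem_uIcc).const_add (A a)).mul (hw x)).sub
        (h2 hx a left_mem_uIcc)
      rwa [sub_self] at h3)
  have ha := hC a left_mem_uIcc
  have hb := hC b right_mem_uIcc
  simp only [Pi.sub_apply, Pi.mul_apply, smul_eq_mul, intervalIntegral.integral_same,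
    sub_zero] at ha hb
  have hcg : ∫ x in a..b, (η x * w x + A x * w' x) = ∫ x in a..b, (η x * w x + B x * w' x) :=
    intervalIntegral.integral_congr fun x hx => by simp only [hB]; rw [← hA x hx]
  rw [hcg, hA b right_mem_uIcc]
  have hBa : B a = A a := by simp [hB]
  rw [hBa] at ha
  simp only [hB] at hb ⊢
  rw [← ha] at hb
  linear_combination -hb

theorem inner_eq_intervalIntegral (f h : L2) :
    inner ℂ f h = ∫ x in (-1 / 2 : ℝ)..(1 / 2), starRingEnd ℂ (f x) * h x := by
  rw [L2.inner_def, intervalIntegral.integral_of_le (by norm_num), integral_Ioc_eq_integral_Ioo]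
  refine integral_congr_ae (Eventually.of_forall fun x => ?_)
  simp [mul_comm]

theorem IsPeriodicH1.integral_mul_add {u : ℝ → ℂ} {f v : L2} (h : IsPeriodicH1 u f v)
    {w w' : ℝ → ℂ} {a b : ℝ} (ha : a ∈ Icc (-1 / 2 : ℝ) (1 / 2))
    (hb : b ∈ Icc (-1 / 2 : ℝ) (1 / 2)) (hw : ∀ x, HasDerivAt w (w' x) x)
    (hw' : Continuous w') :
    ∫ x in a..b, (starRingEnd ℂ (v x) * w x + starRingEnd ℂ (u x) * w' x)
      = starRingEnd ℂ (u b) * w b - starRingEnd ℂ (u a) * w a := by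
  have hint : ∀ x ∈ Icc (-1 / 2 : ℝ) (1 / 2), ∀ y ∈ Icc (-1 / 2 : ℝ) (1 / 2),
      IntervalIntegrable v volume x y := fun x hx y hy =>
    (intervalIntegrable_coe v hx).symm.trans (intervalIntegrable_coe v hy)
  have hconj : ∀ x ∈ Icc (-1 / 2 : ℝ) (1 / 2), ∀ y ∈ Icc (-1 / 2 : ℝ) (1 / 2),
      IntervalIntegrable (fun x => starRingEnd ℂ (v x)) volume x y := fun x hx y hy =>
    ⟨Complex.conjCLE.toContinuousLinearMap.integrable_comp (hint x hx y hy).1,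
      Complex.conjCLE.toContinuousLinearMap.integrable_comp (hint x hx y hy).2⟩
  refine integral_deriv_mul_add (A := fun x => starRingEnd ℂ (u x)) (hconj a ha b hb)
    (fun x hx => ?_) hw hw'
  have hx' : x ∈ Icc (-1 / 2 : ℝ) (1 / 2) := uIcc_subset_Icc ha hb hx
  have e : ∫ y in a..x, starRingEnd ℂ (v y) = starRingEnd ℂ (∫ y in a..x, v y) :=
    Complex.conjCLE.toContinuousLinearMap.intervalIntegral_comp_comm (hint a ha x hx')
  rw [e, ← map_add, h.2.1 x hx', h.2.1 a ha, add_assoc,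
    intervalIntegral.integral_add_adjacent_intervals (intervalIntegrable_coe v ha)
      (hint a ha x hx')]

theorem coeFn_ofContinuous {u : ℝ → ℂ} (hu : Continuous u) :
    ofContinuous u hu =ᵐ[cellMeasure] u := MemLp.coeFn_toLp _

theorem inner_eq_intervalIntegral_of_ae {f h : L2} {u w : ℝ → ℂ} (hf : f =ᵐ[cellMeasure] u)
    (hh : h =ᵐ[cellMeasure] w) :
    inner ℂ f h = ∫ x in (-1 / 2 : ℝ)..(1 / 2), starRingEnd ℂ (u x) * w x := by
  rw [L2.inner_def, intervalIntegral.integral_of_le (by norm_num), integral_Ioc_eq_integral_Ioo]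
  refine integral_congr_ae ?_
  filter_upwards [hf, hh] with x h1 h2
  simp [mul_comm, h1, h2]

theorem IsPeriodicH1.intervalIntegrable_mul {u : ℝ → ℂ} {f v : L2} (h : IsPeriodicH1 u f v)
    {w : ℝ → ℂ} (hw : Continuous w) {a b : ℝ} (ha : a ∈ Icc (-1 / 2 : ℝ) (1 / 2))
    (hb : b ∈ Icc (-1 / 2 : ℝ) (1 / 2)) :
    IntervalIntegrable (fun x => starRingEnd ℂ (v x) * w x) volume a b ∧
    IntervalIntegrable (fun x => starRingEnd ℂ (u x) * w x) volume a b := by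
  have hi : IntervalIntegrable v volume a b :=
    (intervalIntegrable_coe v ha).symm.trans (intervalIntegrable_coe v hb)
  have hc : IntervalIntegrable (fun x => starRingEnd ℂ (v x)) volume a b :=
    ⟨Complex.conjCLE.toContinuousLinearMap.integrable_comp hi.1,
      Complex.conjCLE.toContinuousLinearMap.integrable_comp hi.2⟩
  refine ⟨hc.mul_continuousOn hw.continuousOn, ContinuousOn.intervalIntegrable ?_⟩
  exact ((Complex.continuous_conj.comp_continuousOn h.continuousOn).mono
    (uIcc_subset_Icc ha hb)).mul hw.continuousOn

theorem IsPeriodicH1.inner_ofContinuous {u : ℝ → ℂ} {f v : L2} (h : IsPeriodicH1 u f v)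
    {w w' : ℝ → ℂ} (hwc : Continuous w) (hw : ∀ x, HasDerivAt w (w' x) x) (hw' : Continuous w')
    (hp : w (1 / 2) = w (-1 / 2)) :
    inner ℂ v (ofContinuous w hwc) = -inner ℂ f (ofContinuous w' hw') := by
  have h1 := h.integral_mul_add (a := -1 / 2) (b := 1 / 2) (by norm_num) (by norm_num) hw hw'
  have hl : (-1 / 2 : ℝ) ∈ Icc (-1 / 2 : ℝ) (1 / 2) := by norm_num
  have hr : (1 / 2 : ℝ) ∈ Icc (-1 / 2 : ℝ) (1 / 2) := by norm_num
  rw [intervalIntegral.integral_add (h.intervalIntegrable_mul hwc hl hr).1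
    (h.intervalIntegrable_mul hw' hl hr).2, h.2.2, hp, sub_self] at h1
  rw [inner_eq_intervalIntegral_of_ae (ae_eq_refl v) (coeFn_ofContinuous hwc),
    inner_eq_intervalIntegral_of_ae h.1 (coeFn_ofContinuous hw')]
  linear_combination h1

/-! ### Functions of |x| and the jump of their derivative -/

/-- A function of `|x|` with `k'' = -E k` and `k'(1/2) = 0` lies in the periodic Sobolev space, and
its second derivative is `-E k(|x|)` plus `2 k'(0)` times the delta function. -/
theorem exists_isPeriodicH1_comp_abs {k k' : ℝ → ℝ} {E : ℝ} (hk : ∀ x, HasDerivAt k (k' x) x)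
    (hk' : ∀ x, HasDerivAt k' (-E * k x) x) (h0 : k' (1 / 2) = 0)
    (hc : Continuous fun x : ℝ => ((k |x| : ℝ) : ℂ)) :
    ∃ V : L2, IsPeriodicH1 (fun x => ((k |x| : ℝ) : ℂ)) (ofContinuous _ hc) V ∧
      ∀ a φ η, IsPeriodicH1 a φ η →
        inner ℂ η V = E * inner ℂ φ (ofContinuous _ hc) - 2 * k' 0 * starRingEnd ℂ (a 0) := by
  set D : ℝ → ℂ := fun x => if x ≤ 0 then ((-k' (-x) : ℝ) : ℂ) else ((k' x : ℝ) : ℂ) with hD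
  have ck : Continuous k := continuous_iff_continuousAt.2 fun x => (hk x).continuousAt
  have ck' : Continuous k' := continuous_iff_continuousAt.2 fun x => (hk' x).continuousAt
  have cL : Continuous fun x : ℝ => ((-k' (-x) : ℝ) : ℂ) := by fun_prop
  have cR : Continuous fun x : ℝ => ((k' x : ℝ) : ℂ) := by fun_prop
  have mD : Measurable D := Measurable.ite measurableSet_Iic cL.measurable cR.measurable
  have hmem : MemLp D 2 cellMeasure := by
    have h1 := memLp_of_continuous (u := fun x : ℝ => ((k' |x| : ℝ) : ℂ)) (by fun_prop)
    refine h1.mono mD.aestronglyMeasurable (Eventually.of_forall fun x => ?_)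
    simp only [hD]
    split_ifs with hx
    · rw [abs_of_nonpos hx, Complex.ofReal_neg, norm_neg]
    · rw [abs_of_pos (not_le.1 hx)]
  have hV : hmem.toLp D =ᵐ[cellMeasure] D := MemLp.coeFn_toLp _
  have hl : (-1 / 2 : ℝ) ∈ Icc (-1 / 2 : ℝ) (1 / 2) := by norm_num
  have hm : (0 : ℝ) ∈ Icc (-1 / 2 : ℝ) (1 / 2) := by norm_num
  have hr : (1 / 2 : ℝ) ∈ Icc (-1 / 2 : ℝ) (1 / 2) := by norm_num
  refine ⟨hmem.toLp D, ⟨coeFn_ofContinuous hc, fun x hx => ?_, by norm_num⟩,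
    fun a φ η h => ?_⟩
  · rw [intervalIntegral_congr_cell hV hx, integral_eq_of_hasDerivAt_off_countable
      (fun x : ℝ => ((k |x| : ℝ) : ℂ)) D (countable_singleton (0 : ℝ)) hc.continuousOn]
    · ring
    · rintro y ⟨-, hy⟩
      rcases lt_or_gt_of_ne (show y ≠ 0 from hy) with hy | hy
      · have h1 : HasDerivAt (fun z : ℝ => ((k (-z) : ℝ) : ℂ)) ((-k' (-y) : ℝ) : ℂ) y := by
          have := (hk (-y)).comp y (hasDerivAt_neg y)
          simpa using this.ofReal_comp
        simp only [hD, if_pos hy.le]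
        refine h1.congr_of_eventuallyEq ?_
        filter_upwards [Iio_mem_nhds hy] with z hz
        rw [abs_of_neg hz]
      · simp only [hD, if_neg (not_le.2 hy)]
        refine (hk y).ofReal_comp.congr_of_eventuallyEq ?_
        filter_upwards [Ioi_mem_nhds hy] with z hz
        rw [abs_of_pos hz]
    · refine (intervalIntegrable_coe (hmem.toLp D) hx).congr_ae ?_
      rw [uIoc_of_le hx.1]
      have h2 : volume.restrict (Ioc (-1 / 2 : ℝ) x) ≤ cellMeasure := by
        rw [cellMeasure, restrict_Ioo_eq_restrict_Ioc]
        exact Measure.restrict_mono (Ioc_subset_Ioc_right hx.2) le_rfl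
      exact ae_mono h2 hV
  -- Each half of the cell is integrated by parts against a smooth extension of the one-sided
  -- derivative. The outer boundary terms vanish because `k' (1/2) = 0`; the two at the origin add
  -- up to the jump `2 k' 0`.
  · have e1 : ∫ x in (-1 / 2 : ℝ)..0, (starRingEnd ℂ (η x) * ((-k' (-x) : ℝ) : ℂ)
        + starRingEnd ℂ (a x) * (((-E) * k (-x) : ℝ) : ℂ)) = _ :=
      h.integral_mul_add hl hm (w := fun x => ((-k' (-x) : ℝ) : ℂ)) (fun x => by
        have := ((hk' (-x)).comp x (hasDerivAt_neg x)).neg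
        simpa using this.ofReal_comp) (by fun_prop)
    have e2 : ∫ x in (0 : ℝ)..(1 / 2), (starRingEnd ℂ (η x) * ((k' x : ℝ) : ℂ)
        + starRingEnd ℂ (a x) * (((-E) * k x : ℝ) : ℂ)) = _ :=
      h.integral_mul_add hm hr (w := fun x => ((k' x : ℝ) : ℂ))
        (fun x => (hk' x).ofReal_comp) (by fun_prop)
    have iL := h.intervalIntegrable_mul cL hl hm
    have iR := h.intervalIntegrable_mul cR hm hr
    have jL := h.intervalIntegrable_mul (w := fun x => (((-E) * k (-x) : ℝ) : ℂ))
      (by fun_prop) hl hm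
    have jR := h.intervalIntegrable_mul (w := fun x => (((-E) * k x : ℝ) : ℂ))
      (by fun_prop) hm hr
    have cL' : EqOn (fun x => starRingEnd ℂ (η x) * ((-k' (-x) : ℝ) : ℂ))
        (fun x => starRingEnd ℂ (η x) * D x) (uIoc (-1 / 2 : ℝ) 0) := fun x hx => by
      rw [uIoc_of_le (by norm_num)] at hx
      simp only [hD, if_pos hx.2]
    have cR' : EqOn (fun x => starRingEnd ℂ (η x) * ((k' x : ℝ) : ℂ))
        (fun x => starRingEnd ℂ (η x) * D x) (uIoc (0 : ℝ) (1 / 2)) := fun x hx => by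
      rw [uIoc_of_le (by norm_num)] at hx
      simp only [hD, if_neg (not_le.2 hx.1)]
    have dL' : EqOn (fun x => starRingEnd ℂ (a x) * (((-E) * k (-x) : ℝ) : ℂ))
        (fun x => (-E) * (starRingEnd ℂ (a x) * ((k |x| : ℝ) : ℂ))) (uIoc (-1 / 2 : ℝ) 0) :=
      fun x hx => by
      rw [uIoc_of_le (by norm_num)] at hx
      simp only [abs_of_nonpos hx.2]
      push_cast
      ring
    have dR' : EqOn (fun x => starRingEnd ℂ (a x) * (((-E) * k x : ℝ) : ℂ))
        (fun x => (-E) * (starRingEnd ℂ (a x) * ((k |x| : ℝ) : ℂ))) (uIoc (0 : ℝ) (1 / 2)) :=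
      fun x hx => by
      rw [uIoc_of_le (by norm_num)] at hx
      simp only [abs_of_pos hx.1]
      push_cast
      ring
    rw [intervalIntegral.integral_add iL.1 jL.2] at e1
    rw [intervalIntegral.integral_add iR.1 jR.2] at e2
    rw [intervalIntegral.integral_congr_ae (ae_of_all _ fun x hx => cL' hx),
      intervalIntegral.integral_congr_ae (ae_of_all _ fun x hx => dL' hx),
      intervalIntegral.integral_const_mul] at e1
    rw [intervalIntegral.integral_congr_ae (ae_of_all _ fun x hx => cR' hx),
      intervalIntegral.integral_congr_ae (ae_of_all _ fun x hx => dR' hx),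
      intervalIntegral.integral_const_mul] at e2
    rw [inner_eq_intervalIntegral_of_ae (ae_eq_refl η) hV,
      inner_eq_intervalIntegral_of_ae h.1 (coeFn_ofContinuous hc),
      ← intervalIntegral.integral_add_adjacent_intervals (iL.1.congr cL') (iR.1.congr cR'),
      ← intervalIntegral.integral_add_adjacent_intervals (b := 0)
        (h.intervalIntegrable_mul hc hl hm).2 (h.intervalIntegrable_mul hc hm hr).2]
    have z1 : k' (-(-1 / 2)) = 0 := by rw [← h0]; norm_num
    rw [z1] at e1
    rw [h0] at e2
    simp only [neg_zero, Complex.ofReal_neg, Complex.ofReal_zero, mul_zero, sub_zero] at e1 e2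
    linear_combination e1 + e2

noncomputable section

/-! ### Fourier basis and Fourier description of the Sobolev space -/

/-- The frequency `2 π i n`. -/
def freq (n : ℤ) : ℂ := 2 * Real.pi * Complex.I * n

theorem continuous_exp_freq (n : ℤ) : Continuous fun x : ℝ => Complex.exp (freq n * x) := by
  fun_prop

theorem hasDerivAt_exp_freq (n : ℤ) (x : ℝ) :
    HasDerivAt (fun x : ℝ => Complex.exp (freq n * x)) (freq n * Complex.exp (freq n * x)) x := by
  have h1 : HasDerivAt (fun z : ℂ => Complex.exp (freq n * z))
      (Complex.exp (freq n * x) * (freq n * 1)) (x : ℂ) :=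
    ((hasDerivAt_id (x : ℂ)).const_mul (freq n)).cexp
  convert h1.comp_ofReal using 1
  ring

theorem exp_freq_half (n : ℤ) :
    Complex.exp (freq n * ((1 / 2 : ℝ) : ℂ)) = Complex.exp (freq n * ((-1 / 2 : ℝ) : ℂ)) := by
  rw [Complex.exp_eq_exp_iff_exists_int]
  exact ⟨n, by unfold freq; push_cast; ring⟩

theorem conj_freq (n : ℤ) : starRingEnd ℂ (freq n) = -freq n := by
  simp [freq, map_ofNat]

theorem conj_exp_freq (n : ℤ) (x : ℝ) :
    starRingEnd ℂ (Complex.exp (freq n * x)) = Complex.exp (-(freq n * x)) := by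
  rw [← Complex.exp_conj, map_mul, conj_freq, Complex.conj_ofReal, neg_mul]

/-- The plane wave `exp (2 π i n x)` as an element of `L²`. -/
def wave (n : ℤ) : L2 := ofContinuous _ (continuous_exp_freq n)

theorem isPeriodicH1_wave (n : ℤ) :
    IsPeriodicH1 (fun x : ℝ => Complex.exp (freq n * x)) (wave n) (freq n • wave n) :=
  isPeriodicH1_of_hasDerivAt (hasDerivAt_exp_freq n) (by fun_prop) (exp_freq_half n)

/-- Periodicity cancels the boundary terms, so differentiation becomes a Fourier multiplier. This
turns every later statement about weak derivatives into one about coefficients. -/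
theorem IsPeriodicH1.inner_wave {u : ℝ → ℂ} {f v : L2} (h : IsPeriodicH1 u f v) (n : ℤ) :
    inner ℂ (wave n) v = freq n * inner ℂ (wave n) f := by
  have h1 : inner ℂ v (wave n) = -inner ℂ f (freq n • wave n) :=
    h.inner_ofContinuous (continuous_exp_freq n) (hasDerivAt_exp_freq n) (by fun_prop)
      (exp_freq_half n)
  rw [inner_smul_right] at h1
  rw [← inner_conj_symm, h1, map_neg, map_mul, inner_conj_symm, conj_freq]
  ring

theorem inner_wave_eq (n : ℤ) (f : L2) : inner ℂ (wave n) f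
    = ∫ x in (-1 / 2 : ℝ)..(1 / 2), Complex.exp (-(freq n * x)) * f x := by
  rw [wave, inner_eq_intervalIntegral_of_ae (coeFn_ofContinuous (continuous_exp_freq n))
    (ae_eq_refl f)]
  simp only [conj_exp_freq]

theorem freq_inj {m n : ℤ} (h : freq m = freq n) : m = n := by
  unfold freq at h
  have h1 := mul_left_cancel₀ Complex.two_pi_I_ne_zero h
  exact_mod_cast h1

theorem inner_wave_self (n : ℤ) : inner ℂ (wave n) (wave n) = (1 : ℂ) := by
  have h := coeFn_ofContinuous (continuous_exp_freq n)
  rw [wave, inner_eq_intervalIntegral_of_ae h h]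
  simp only [conj_exp_freq, ← Complex.exp_add, neg_add_cancel, Complex.exp_zero]
  norm_num

theorem orthonormal_wave : Orthonormal ℂ wave := by
  rw [orthonormal_iff_ite]
  intro m n
  split_ifs with h
  · rw [h, inner_wave_self]
  · have h1 := (isPeriodicH1_wave n).inner_wave m
    rw [inner_smul_right] at h1
    have h2 : (freq n - freq m) * inner ℂ (wave m) (wave n) = 0 := by linear_combination h1
    rcases mul_eq_zero.1 h2 with h3 | h3
    · exact absurd (freq_inj (sub_eq_zero.1 h3)).symm h
    · exact h3

/-- Completeness of the plane waves, read off from Parseval's identity on an interval of length one.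
-/
theorem eq_zero_of_inner_wave {f : L2} (hf : ∀ n, inner ℂ (wave n) f = 0) : f = 0 := by
  have hab : (-1 / 2 : ℝ) < 1 / 2 := by norm_num
  have hmem : MemLp f 2 (volume.restrict (Ioc (-1 / 2 : ℝ) (1 / 2))) := by
    rw [← restrict_Ioo_eq_restrict_Ioc]; exact Lp.memLp f
  have h1 := hasSum_sq_fourierCoeffOn hab hmem
  have h2 : ∀ n, fourierCoeffOn hab f n = 0 := fun n => by
    rw [fourierCoeffOn_eq_integral]
    refine smul_eq_zero_of_right _ ?_
    rw [← hf n, inner_wave_eq]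
    refine intervalIntegral.integral_congr fun x _ => ?_
    simp only [fourier_coe_apply, smul_eq_mul]
    congr 2
    unfold freq
    push_cast
    ring
  simp only [h2, norm_zero, ne_eq, OfNat.ofNat_ne_zero, not_false_eq_true, zero_pow] at h1
  have h3 : ∫ x in (-1 / 2 : ℝ)..(1 / 2), ‖f x‖ ^ 2 = 0 := by
    have := h1.unique hasSum_zero
    norm_num at this
    norm_num
    exact this
  have h4 : inner ℂ f f = (0 : ℂ) := by
    rw [inner_eq_intervalIntegral]
    have : ∀ x, starRingEnd ℂ (f x) * f x = ((‖f x‖ ^ 2 : ℝ) : ℂ) := fun x => by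
      rw [Complex.conj_mul']; push_cast; rfl
    simp only [this]
    rw [intervalIntegral.integral_ofReal, h3, Complex.ofReal_zero]
  exact inner_self_eq_zero.1 h4

/-- The Fourier basis of `L²`. -/
def waveBasis : HilbertBasis ℤ ℂ L2 :=
  HilbertBasis.mkOfOrthogonalEqBot orthonormal_wave (by
    rw [Submodule.eq_bot_iff]
    intro f hf
    refine eq_zero_of_inner_wave fun n => ?_
    exact (Submodule.mem_orthogonal _ _).1 hf _ (Submodule.subset_span ⟨n, rfl⟩))

@[simp] theorem coe_waveBasis (n : ℤ) : waveBasis n = wave n := by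
  simp [waveBasis]

theorem _root_.HilbertBasis.ext_inner {ι H : Type*} [NormedAddCommGroup H] [InnerProductSpace ℂ H]
    (b : HilbertBasis ι ℂ H) {f f' : H}
    (h : ∀ i, inner ℂ (b i) f = inner ℂ (b i) f') : f = f' := by
  refine b.repr.injective (lp.ext (funext fun i => ?_))
  rw [b.repr_apply_apply, b.repr_apply_apply, h]

/-- Bounded multipliers preserve square summability. This produces weak derivatives from prescribed
coefficients. -/
theorem _root_.HilbertBasis.exists_multiplier {ι H : Type*} [NormedAddCommGroup H]
    [InnerProductSpace ℂ H] (b : HilbertBasis ι ℂ H) {m : ι → ℂ} {K : ℝ} (hm : ∀ i, ‖m i‖ ≤ K)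
    (w : H) : ∃ v, ∀ i, inner ℂ (b i) v = m i * inner ℂ (b i) w := by
  have h1 : Memℓp (fun i => m i * b.repr w i) 2 := by
    refine memℓp_gen ?_
    have h2 : Summable fun i => ‖b.repr w i‖ ^ (2 : ENNReal).toReal :=
      (lp.memℓp (b.repr w)).summable (by norm_num)
    refine Summable.of_nonneg_of_le (fun i => by positivity) (fun i => ?_)
      (h2.mul_left (K ^ (2 : ENNReal).toReal))
    rw [norm_mul, Real.mul_rpow (norm_nonneg _) (norm_nonneg _)]
    gcongr
    exact hm i
  refine ⟨b.repr.symm ⟨_, h1⟩, fun i => ?_⟩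
  rw [← b.repr_apply_apply, ← b.repr_apply_apply, LinearIsometryEquiv.apply_symm_apply]

theorem IsPeriodicH1.const (c : ℂ) : IsPeriodicH1 (fun _ => c) (c • wave 0) 0 := by
  have h := (isPeriodicH1_wave 0).smul c
  have h0 : freq 0 = 0 := by simp [freq]
  rw [h0, zero_smul, smul_zero] at h
  convert h using 1
  ext x
  simp

/-- The Fourier description of the periodic Sobolev space. -/
theorem exists_isPeriodicH1_of_inner_wave {f v : L2}
    (h : ∀ n, inner ℂ (wave n) v = freq n * inner ℂ (wave n) f) : ∃ u, IsPeriodicH1 u f v := by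
  have hl : (-1 / 2 : ℝ) ∈ Icc (-1 / 2 : ℝ) (1 / 2) := by norm_num
  have hr : (1 / 2 : ℝ) ∈ Icc (-1 / 2 : ℝ) (1 / 2) := by norm_num
  set U : ℝ → ℂ := fun x => ∫ y in (-1 / 2 : ℝ)..x, v y with hU
  have hf0 : freq 0 = 0 := by simp [freq]
  -- The zeroth coefficient of `v` is its integral over the cell, and it vanishes because `freq 0 =
  -- 0`.
  have hper : U (1 / 2) = U (-1 / 2) := by
    have h0 := h 0
    rw [inner_wave_eq, hf0] at h0
    simpa [hU] using h0
  have hUc : ContinuousOn U (Icc (-1 / 2 : ℝ) (1 / 2)) := by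
    have h2 := intervalIntegral.continuousOn_primitive_interval' (intervalIntegrable_coe v hr)
      left_mem_uIcc
    rwa [uIcc_of_le (by norm_num)] at h2
  have hUm : MemLp U 2 cellMeasure := by
    obtain ⟨K, hK⟩ := isCompact_Icc.exists_bound_of_continuousOn hUc
    refine MemLp.of_bound ((hUc.mono Ioo_subset_Icc_self).aestronglyMeasurable measurableSet_Ioo)
      K ((ae_restrict_iff' measurableSet_Ioo).2 (ae_of_all _ fun x hx =>
        hK x (Ioo_subset_Icc_self hx)))
  have hF : IsPeriodicH1 U (hUm.toLp U) v :=
    ⟨MemLp.coeFn_toLp _, fun x _ => by simp [hU], hper⟩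
  set c : ℂ := inner ℂ (wave 0) (f - hUm.toLp U)
  -- For `n ≠ 0` the factor `freq n` cancels, so `f` and the primitive of `v` differ only in the
  -- zeroth mode.
  have hfc : f = hUm.toLp U + c • wave 0 := by
    refine waveBasis.ext_inner fun n => ?_
    rw [coe_waveBasis, inner_add_right, inner_smul_right, orthonormal_iff_ite.1 orthonormal_wave]
    split_ifs with hn
    · subst hn
      simp only [c, inner_sub_right]
      ring
    · have h1 := hF.inner_wave n
      rw [h n] at h1
      have h2 : freq n ≠ 0 := fun h3 => hn (freq_inj (h3.trans hf0.symm))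
      rw [mul_left_cancel₀ h2 h1]
      ring
  refine ⟨U + fun _ => c, ?_⟩
  have h3 := hF.add (IsPeriodicH1.const c)
  rwa [add_zero, ← hfc] at h3

/-! ### Free resolvent, Green function and the rank-one perturbation -/

theorem freq_sq (n : ℤ) : freq n ^ 2 = ((-(4 * Real.pi ^ 2 * (n : ℝ) ^ 2) : ℝ) : ℂ) := by
  unfold freq
  push_cast
  linear_combination (4 * Real.pi ^ 2 * n ^ 2 : ℂ) * Complex.I_sq

theorem norm_freq (n : ℤ) : ‖freq n‖ = 2 * Real.pi * |(n : ℝ)| := by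
  simp [freq, abs_of_pos Real.pi_pos]

/-- The eigenvalues of the resolvent of the free Hamiltonian at `-1`. -/
def freeWeight (n : ℤ) : ℝ := (4 * Real.pi ^ 2 * (n : ℝ) ^ 2 + 1)⁻¹

theorem freeWeight_pos (n : ℤ) : 0 < freeWeight n := by
  unfold freeWeight; positivity

theorem one_sub_freq_sq_mul_freeWeight (n : ℤ) : (1 - freq n ^ 2) * (freeWeight n : ℂ) = 1 := by
  rw [freq_sq, freeWeight]
  have : (4 * Real.pi ^ 2 * (n : ℝ) ^ 2 + 1) ≠ 0 := by positivity
  rw [← Complex.ofReal_one, ← Complex.ofReal_sub, ← Complex.ofReal_mul]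
  congr 1
  field_simp
  ring

theorem summable_freeWeight : Summable freeWeight := by
  refine Summable.of_norm_bounded_eventually (Real.summable_one_div_int_pow.2 one_lt_two) ?_
  filter_upwards [(Set.finite_singleton (0 : ℤ)).compl_mem_cofinite] with n hn
  have hn' : (n : ℝ) ≠ 0 := by exact_mod_cast hn
  rw [Real.norm_of_nonneg (freeWeight_pos n).le, freeWeight, one_div]
  refine inv_anti₀ (by positivity) ?_
  have : 1 ≤ 4 * Real.pi ^ 2 := by nlinarith [Real.pi_gt_three]
  nlinarith [sq_nonneg (n : ℝ)]

theorem norm_freq_mul_freeWeight_le (n : ℤ) : ‖freq n * freeWeight n‖ ≤ 1 := by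
  rw [norm_mul, norm_freq, Complex.norm_real, Real.norm_of_nonneg (freeWeight_pos n).le,
    freeWeight, ← div_eq_mul_inv, div_le_one (by positivity), ← sq_abs (n : ℝ)]
  nlinarith [sq_nonneg (2 * Real.pi * |(n : ℝ)| - 1)]

theorem norm_innerSL_smulRight_wave (n : ℤ) :
    ‖(freeWeight n : ℂ) • (innerSL ℂ (wave n)).smulRight (wave n)‖ = freeWeight n := by
  rw [norm_smul, ContinuousLinearMap.norm_smulRight_apply, innerSL_apply_norm,
    orthonormal_wave.1 n, Complex.norm_real, Real.norm_of_nonneg (freeWeight_pos n).le]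
  ring

theorem summable_freeResolvent : Summable fun n : ℤ =>
    (freeWeight n : ℂ) • (innerSL ℂ (wave n)).smulRight (wave n) :=
  Summable.of_norm (by simpa only [norm_innerSL_smulRight_wave] using summable_freeWeight)

/-- The resolvent of the free Hamiltonian at `-1`. -/
def freeResolvent : L2 →L[ℂ] L2 :=
  ∑' n : ℤ, (freeWeight n : ℂ) • (innerSL ℂ (wave n)).smulRight (wave n)

theorem isCompactOperator_smulRight {H : Type*} [NormedAddCommGroup H] [NormedSpace ℂ H]
    (φ : H →L[ℂ] ℂ) (x : H) : IsCompactOperator (φ.smulRight x) := by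
  have h : IsCompactOperator (ContinuousLinearMap.id ℂ ℂ) :=
    isCompactOperator_id_iff_locallyCompactSpace.2 inferInstance
  exact (h.clm_comp ((ContinuousLinearMap.id ℂ ℂ).smulRight x)).comp_clm φ

/-- The rank-one summands have summable norms, so the operator is a norm limit of finite-rank
partial sums. -/
theorem isCompactOperator_freeResolvent : IsCompactOperator freeResolvent := by
  refine isCompactOperator_of_tendsto summable_freeResolvent.hasSum (Eventually.of_forall ?_)
  intro s
  have : (∑ n ∈ s, (freeWeight n : ℂ) • (innerSL ℂ (wave n)).smulRight (wave n)) ∈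
      compactOperator (RingHom.id ℂ) L2 L2 :=
    Submodule.sum_mem _ fun n _ => Submodule.smul_mem _ _ (isCompactOperator_smulRight _ _)
  exact this

theorem inner_wave_freeResolvent (n : ℤ) (w : L2) :
    inner ℂ (wave n) (freeResolvent w) = freeWeight n * inner ℂ (wave n) w := by
  have h1 : HasSum (fun m : ℤ => ((freeWeight m : ℂ) * inner ℂ (wave m) w) • wave m)
      (freeResolvent w) := by
    have := (ContinuousLinearMap.apply ℂ L2 w).hasSum summable_freeResolvent.hasSum
    have e : (fun m : ℤ => ((freeWeight m : ℂ) * inner ℂ (wave m) w) • wave m) = fun m =>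
        ContinuousLinearMap.apply ℂ L2 w
          ((freeWeight m : ℂ) • (innerSL ℂ (wave m)).smulRight (wave m)) := funext fun m => by
      rw [mul_smul]; rfl
    rw [e]
    exact this
  have h2 := (innerSL ℂ (wave n)).hasSum h1
  refine h2.unique ?_
  convert hasSum_single n ?_ using 1
  · rw [innerSL_apply_apply, inner_smul_right, inner_wave_self, mul_one]
  · intro m hm
    simp only [innerSL_apply_apply, inner_smul_right,
      orthonormal_iff_ite.1 orthonormal_wave, if_neg hm.symm, mul_zero]

/-- The free resolvent solves the weak form of `-f'' + f = w`. -/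
theorem exists_isPeriodicH1_freeResolvent (w : L2) :
    ∃ u v, IsPeriodicH1 u (freeResolvent w) v ∧ ∀ a φ η, IsPeriodicH1 a φ η →
      inner ℂ η v + inner ℂ φ (freeResolvent w) = inner ℂ φ w := by
  obtain ⟨v, hv⟩ := waveBasis.exists_multiplier norm_freq_mul_freeWeight_le w
  simp only [coe_waveBasis] at hv
  obtain ⟨u, hu⟩ := exists_isPeriodicH1_of_inner_wave (f := freeResolvent w) (v := v)
    fun n => by rw [hv, inner_wave_freeResolvent, mul_assoc]
  refine ⟨u, v, hu, fun a φ η h => ?_⟩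
  -- The weak equation is compared mode by mode through Parseval; each mode reduces to `(1 - freq n
  -- ^ 2) * freeWeight n = 1`.
  refine ((waveBasis.hasSum_inner_mul_inner η v).add
    (waveBasis.hasSum_inner_mul_inner φ (freeResolvent w))).unique ?_
  convert waveBasis.hasSum_inner_mul_inner φ w using 2 with n
  simp only [coe_waveBasis]
  rw [hv, inner_wave_freeResolvent, ← inner_conj_symm η, h.inner_wave, map_mul, inner_conj_symm,
    conj_freq]
  linear_combination (inner ℂ φ (wave n) * inner ℂ (wave n) w) * one_sub_freq_sq_mul_freeWeight n

/-- The Green function of the free Hamiltonian at `-1`. -/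
theorem exists_green : ∃ (γ : ℝ → ℂ) (G V : L2) (r : ℝ), 0 < r ∧ γ 0 = r ∧ IsPeriodicH1 γ G V ∧
    ∀ a φ η, IsPeriodicH1 a φ η → inner ℂ η V + inner ℂ φ G = starRingEnd ℂ (a 0) := by
  have hs : 0 < Real.sinh (1 / 2) := Real.sinh_pos_iff.2 (by norm_num)
  -- The shift by `1/2` gives `k' (1/2) = 0`, and the normalization gives `k' 0 = -1/2`, so that the
  -- delta term has coefficient one.
  set k : ℝ → ℝ := fun x => Real.cosh (x - 1 / 2) / (2 * Real.sinh (1 / 2)) with hk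
  set k' : ℝ → ℝ := fun x => Real.sinh (x - 1 / 2) / (2 * Real.sinh (1 / 2)) with hk'
  have h1 : ∀ x, HasDerivAt k (k' x) x := fun x => by
    have := ((Real.hasDerivAt_cosh (x - 1 / 2)).comp x ((hasDerivAt_id x).sub_const (1 / 2)))
    simpa [hk, hk'] using this.div_const (2 * Real.sinh (1 / 2))
  have h2 : ∀ x, HasDerivAt k' (-(-1) * k x) x := fun x => by
    have := ((Real.hasDerivAt_sinh (x - 1 / 2)).comp x ((hasDerivAt_id x).sub_const (1 / 2)))
    simpa [hk, hk'] using this.div_const (2 * Real.sinh (1 / 2))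
  have hc : Continuous fun x : ℝ => ((k |x| : ℝ) : ℂ) := by
    have : Continuous k := continuous_iff_continuousAt.2 fun x => (h1 x).continuousAt
    fun_prop
  obtain ⟨V, hV, h⟩ := exists_isPeriodicH1_comp_abs h1 h2 (by simp [hk']) hc
  refine ⟨_, _, V, k 0, by simp only [hk]; positivity, by simp, hV, fun a φ η ha => ?_⟩
  have h0 : k' 0 = -1 / 2 := by
    simp only [hk', zero_sub, Real.sinh_neg]
    field_simp
  rw [h a φ η ha, h0]
  push_cast
  ring

/-- The resolvent of the Hamiltonian at `-1` exists and is compact. -/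
theorem exists_resolvent {g : ℝ} (hg : 0 < g) : ∃ T : L2 →L[ℂ] L2, IsCompactOperator T ∧
    ∀ w, (T w, w - T w) ∈ deltaGraph g := by
  obtain ⟨γ, G, V, r, hr, hγ, hG, hgreen⟩ := exists_green
  -- Subtracting `c ⟨G, w⟩ G` leaves the value `(1 - c r) ⟨G, w⟩` at the origin. The delta term
  -- requires `c = g (1 - c r)`, which determines `c`.
  set c : ℂ := g / (1 + g * r) with hc
  have hne : (1 + g * r : ℂ) ≠ 0 := by
    have : (1 + g * r : ℝ) ≠ 0 := by positivity
    exact_mod_cast this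
  refine ⟨freeResolvent - c • (innerSL ℂ G).smulRight G,
    isCompactOperator_freeResolvent.sub ((isCompactOperator_smulRight _ _).smul c), fun w => ?_⟩
  obtain ⟨u, v, hu, hfree⟩ := exists_isPeriodicH1_freeResolvent w
  -- Testing the Green function's equation with `u`, and the equation of `u` with `G`, yields the
  -- same form value.
  have hu0 : u 0 = inner ℂ G w := by
    have e1 := hgreen _ _ _ hu
    have e2 := hfree _ _ _ hG
    rw [← e2, ← inner_conj_symm V, ← inner_conj_symm G, ← map_add, e1, Complex.conj_conj]
  have hT : (freeResolvent - c • (innerSL ℂ G).smulRight G) w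
      = freeResolvent w + (-(c * inner ℂ G w)) • G := by
    simp [smul_smul, sub_eq_add_neg]
  rw [hT]
  refine ⟨_, _, hu.add (hG.smul _), fun a φ η h => ?_⟩
  have e1 := hgreen _ _ _ h
  have e2 := hfree _ _ _ h
  simp only [inner_add_right, inner_sub_right, inner_smul_right, Pi.add_apply, Pi.smul_apply,
    smul_eq_mul, hγ, hu0]
  have e3 : c * (1 + g * r) = g := by rw [hc]; field_simp
  linear_combination e2 - (c * inner ℂ G w) * e1 - starRingEnd ℂ (a 0) * inner ℂ G w * e3

/-! ### Symmetry, positivity and the eigenbasis -/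

/-- The quadratic form is Hermitian: each equation is tested with the other function. -/
theorem deltaGraph_symm {g : ℝ} {f w f' w' : L2} (h : (f, w) ∈ deltaGraph g)
    (h' : (f', w') ∈ deltaGraph g) : inner ℂ f w' = inner ℂ w f' := by
  obtain ⟨u, v, hu, e⟩ := h
  obtain ⟨u', v', hu', e'⟩ := h'
  rw [← inner_conj_symm w, ← e _ _ _ hu', ← e' _ _ _ hu]
  simp only [map_add, map_mul, Complex.conj_conj, Complex.conj_ofReal, inner_conj_symm]
  ring

theorem deltaGraph_inner {g : ℝ} {f w : L2} (h : (f, w) ∈ deltaGraph g) :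
    ∃ u v, IsPeriodicH1 u f v ∧ inner ℂ f w = ((‖v‖ ^ 2 + g * ‖u 0‖ ^ 2 : ℝ) : ℂ) := by
  obtain ⟨u, v, hu, e⟩ := h
  refine ⟨u, v, hu, ?_⟩
  rw [← e _ _ _ hu, inner_self_eq_norm_sq_to_K, Complex.conj_mul']
  push_cast
  rfl

/-- The form is nonnegative. If it vanishes then the derivative is zero and, because `g > 0`, so is
the value at the origin; the remaining constant is therefore zero. -/
theorem deltaGraph_eq_zero_of_nonpos {g E : ℝ} (hg : 0 < g) (hE : E ≤ 0) {f : L2}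
    (h : (f, (E : ℂ) • f) ∈ deltaGraph g) : f = 0 := by
  obtain ⟨u, v, hu, e⟩ := deltaGraph_inner h
  rw [inner_smul_right, inner_self_eq_norm_sq_to_K] at e
  have e' : E * ‖f‖ ^ 2 = ‖v‖ ^ 2 + g * ‖u 0‖ ^ 2 := by
    have e2 : ((E * ‖f‖ ^ 2 : ℝ) : ℂ) = ((‖v‖ ^ 2 + g * ‖u 0‖ ^ 2 : ℝ) : ℂ) := by
      rw [← e]; push_cast; rfl
    exact Complex.ofReal_injective e2
  have h1 : 0 ≤ g * ‖u 0‖ ^ 2 := by positivity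
  have h2 : E * ‖f‖ ^ 2 ≤ 0 := mul_nonpos_of_nonpos_of_nonneg hE (by positivity)
  have h3 : ‖v‖ = 0 := by nlinarith [norm_nonneg v]
  have h4 : ‖u 0‖ ^ 2 = 0 := by
    rw [h3] at e'
    have : g * ‖u 0‖ ^ 2 = 0 := by nlinarith
    exact (mul_eq_zero.1 this).resolve_left hg.ne'
  have h5 : u 0 = 0 := by simpa using h4
  have h6 : v = 0 := by simpa using h3
  have h7 : ∀ x ∈ Icc (-1 / 2 : ℝ) (1 / 2), u x = u (-1 / 2) := fun x hx => by
    rw [hu.2.1 x hx, h6, intervalIntegral_congr_cell (Lp.coeFn_zero ℂ 2 cellMeasure) hx]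
    simp
  rw [Lp.eq_zero_iff_ae_eq_zero]
  refine hu.1.trans ((ae_restrict_iff' measurableSet_Ioo).2 (ae_of_all _ fun x hx => ?_))
  rw [h7 x (Ioo_subset_Icc_self hx), ← h7 0 (by norm_num), h5, Pi.zero_apply]

/-- Two solutions of the resolvent equation differ by an eigenvector for `-1`, which positivity of
the form excludes. -/
theorem resolvent_apply {g : ℝ} (hg : 0 < g) {T : L2 →L[ℂ] L2}
    (hT : ∀ w, (T w, w - T w) ∈ deltaGraph g) {f w : L2} (h : (f, w) ∈ deltaGraph g) :
    T (w + f) = f := by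
  have h1 := (deltaGraph g).sub_mem h (hT (w + f))
  have h2 : (f - T (w + f), ((-1 : ℝ) : ℂ) • (f - T (w + f))) ∈ deltaGraph g := by
    convert h1 using 1
    ext1
    · rfl
    · simp only [Prod.snd_sub, Complex.ofReal_neg, Complex.ofReal_one, neg_smul, one_smul]
      abel
  exact (sub_eq_zero.1 (deltaGraph_eq_zero_of_nonpos hg (by norm_num) h2)).symm

theorem resolvent_isSymmetric {g : ℝ} {T : L2 →L[ℂ] L2}
    (hT : ∀ w, (T w, w - T w) ∈ deltaGraph g) : (T : L2 →ₗ[ℂ] L2).IsSymmetric := by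
  intro x y
  have h := deltaGraph_symm (hT x) (hT y)
  rw [inner_sub_right, inner_sub_left] at h
  simp only [ContinuousLinearMap.coe_coe]
  linear_combination h

/-- A compact symmetric operator has a Hilbert basis of eigenvectors. -/
theorem _root_.IsCompactOperator.exists_hilbertBasis_eigenvectors {H : Type*} [NormedAddCommGroup H]
    [InnerProductSpace ℂ H] [CompleteSpace H] {T : H →L[ℂ] H} (hc : IsCompactOperator T)
    (hs : (T : H →ₗ[ℂ] H).IsSymmetric) :
    ∃ (s : Set H) (b : HilbertBasis s ℂ H) (μ : s → ℝ), ∀ i, T (b i) = (μ i : ℂ) • b i := by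
  classical
  have hclosed : ∀ μ : ℂ, IsClosed (Module.End.eigenspace (T : Module.End ℂ H) μ : Set H) :=
    fun μ => by
    have : (Module.End.eigenspace (T : Module.End ℂ H) μ : Set H) = {x | T x = μ • x} := by
      ext x
      simp
    rw [this]
    exact isClosed_eq T.continuous (continuous_const_smul μ)
  have hcs : ∀ μ : ℂ, CompleteSpace (Module.End.eigenspace (T : Module.End ℂ H) μ) := fun μ =>
    (hclosed μ).completeSpace_coe
  choose W B hB using fun μ : ℂ =>
    _root_.exists_hilbertBasis ℂ (Module.End.eigenspace (T : Module.End ℂ H) μ)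
  have hortho := hs.orthogonalFamily_eigenspaces.orthonormal_sigma_orthonormal
    fun μ => (B μ).orthonormal
  set V : (Σ μ : ℂ, W μ) → H := fun a => ((B a.1 a.2 : _) : H) with hV
  have hVo : Orthonormal ℂ V := hortho
  have hreal : ∀ a, ∃ r : ℝ, T (V a) = (r : ℂ) • V a := by
    rintro ⟨μ, w⟩
    have h1 : T (V ⟨μ, w⟩) = μ • V ⟨μ, w⟩ := Module.End.mem_eigenspace_iff.1 (B μ w).2
    have h2 : Module.End.HasEigenvalue (T : Module.End ℂ H) μ :=
      Module.End.hasEigenvalue_of_hasEigenvector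
        ⟨Module.End.mem_eigenspace_iff.2 h1, hVo.ne_zero ⟨μ, w⟩⟩
    have h3 := hs.conj_eigenvalue_eq_self h2
    obtain ⟨r, hr⟩ := Complex.conj_eq_iff_real.1 h3
    exact ⟨r, by rw [← hr]; exact h1⟩
  -- A vector orthogonal to the chosen bases is orthogonal to every eigenspace, so the spectral
  -- theorem for compact symmetric operators makes it zero.
  have hbot : (Submodule.span ℂ (range V))ᗮ = ⊥ := by
    rw [Submodule.eq_bot_iff]
    intro f hf
    have h0 : ∀ a, inner ℂ (V a) f = 0 := fun a =>
      (Submodule.mem_orthogonal _ _).1 hf _ (Submodule.subset_span ⟨a, rfl⟩)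
    have h1 : f ∈ (⨆ μ, Module.End.eigenspace (T : Module.End ℂ H) μ)ᗮ := by
      rw [← Submodule.iInf_orthogonal, Submodule.mem_iInf]
      intro μ
      have h2 := (B μ).hasSum_orthogonalProjectionOnto f
      have h3 : ∀ i, inner ℂ ((B μ i : _) : H) f = 0 := fun i => h0 ⟨μ, i⟩
      simp only [h3, zero_smul] at h2
      exact Submodule.orthogonalProjectionOnto_eq_zero_iff.1 (h2.unique hasSum_zero)
    rw [ContinuousLinearMap.orthogonalComplement_iSup_eigenspaces_eq_bot hc hs] at h1
    exact h1
  let e : range V ≃ Σ μ : ℂ, W μ := (Equiv.ofInjective V hVo.linearIndependent.injective).symm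
  have heV : ∀ i, V (e i) = i := fun i => Equiv.apply_ofInjective_symm _ i
  have ho : Orthonormal ℂ ((↑) : range V → H) := hVo.toSubtypeRange
  choose r hr using hreal
  refine ⟨range V, HilbertBasis.mkOfOrthogonalEqBot ho (by rwa [Subtype.range_coe]),
    fun i => r (e i), fun i => ?_⟩
  rw [HilbertBasis.coe_mkOfOrthogonalEqBot, ← heV i]
  exact hr (e i)

/-- Each `c k` has only countably many nonzero coefficients in `b`, and every `b i` pairs
nontrivially with some `c k`. -/
theorem _root_.HilbertBasis.countable_of_countable {ι κ H : Type*} [NormedAddCommGroup H]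
    [InnerProductSpace ℂ H] [Countable κ] (b : HilbertBasis ι ℂ H) (c : HilbertBasis κ ℂ H) :
    Countable ι := by
  have h1 : ∀ k, {i | inner ℂ (c k) (b i) * inner ℂ (b i) (c k) ≠ 0}.Countable := fun k =>
    (b.summable_inner_mul_inner (c k) (c k)).countable_support
  have h2 : (univ : Set ι) ⊆ ⋃ k, {i | inner ℂ (c k) (b i) * inner ℂ (b i) (c k) ≠ 0} := by
    intro i _
    by_contra hi
    simp only [mem_iUnion, mem_ofPred_eq, not_exists, not_not] at hi
    refine b.orthonormal.ne_zero i (c.ext_inner fun k => ?_)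
    rw [inner_zero_right]
    rcases mul_eq_zero.1 (hi k) with h | h
    · exact h
    · rw [← inner_conj_symm, h, map_zero]
  exact countable_univ_iff.1 ((countable_iUnion h1).mono h2)

theorem _root_.HilbertBasis.infinite_of_infinite {ι κ H : Type*} [NormedAddCommGroup H]
    [InnerProductSpace ℂ H] [Infinite κ] (b : HilbertBasis ι ℂ H) (c : HilbertBasis κ ℂ H) :
    Infinite ι := by
  by_contra hfin
  rw [not_infinite_iff_finite] at hfin
  have := Fintype.ofFinite ι
  have : FiniteDimensional ℂ H := b.toOrthonormalBasis.toBasis.finiteDimensional_of_finite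
  exact not_finite_iff_infinite.2 ‹Infinite κ› c.orthonormal.linearIndependent.finite

/-- The Hamiltonian has an orthonormal basis of eigenfunctions. -/
theorem exists_hilbertBasis_deltaGraph {g : ℝ} (hg : 0 < g) :
    ∃ (b : HilbertBasis ℕ ℂ L2) (E : ℕ → ℝ), ∀ n, (b n, (E n : ℂ) • b n) ∈ deltaGraph g := by
  obtain ⟨T, hc, hT⟩ := exists_resolvent hg
  obtain ⟨s, b, μ, hb⟩ := hc.exists_hilbertBasis_eigenvectors (resolvent_isSymmetric hT)
  have := b.countable_of_countable waveBasis
  have := b.infinite_of_infinite waveBasis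
  obtain ⟨hd⟩ := nonempty_denumerable s
  let e : ℕ ≃ s := (Denumerable.eqv s).symm
  have ho : Orthonormal ℂ (b ∘ e) := b.orthonormal.comp e e.injective
  -- An eigenvalue `μ` of the resolvent at `-1` corresponds to the energy `μ⁻¹ - 1`.
  refine ⟨HilbertBasis.mk ho (by
    rw [e.surjective.range_comp, b.dense_span]), fun n => (μ (e n))⁻¹ - 1, fun n => ?_⟩
  rw [HilbertBasis.coe_mk]
  simp only [Function.comp_apply]
  set i := e n
  -- If `T` killed a basis vector, the graph would contain a pair with first entry zero and nonzero
  -- second entry.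
  have hμ : (μ i : ℂ) ≠ 0 := by
    intro h0
    have h1 := hT (b i)
    rw [hb, h0, zero_smul, sub_zero] at h1
    exact b.orthonormal.ne_zero i (deltaGraph_snd_eq_zero g _ h1 rfl)
  have h2 := (deltaGraph g).smul_mem (μ i : ℂ)⁻¹ (hT (b i))
  rw [hb] at h2
  convert h2 using 1
  ext1
  · rw [Prod.smul_mk, smul_smul, inv_mul_cancel₀ hμ, one_smul]
  · simp only [Prod.smul_mk, smul_sub, smul_smul, inv_mul_cancel₀ hμ]
    push_cast
    rw [sub_smul]

/-- The graph of the Hamiltonian in terms of a basis of eigenfunctions. -/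
theorem mem_deltaGraph_iff {g : ℝ} (hg : 0 < g) {ι : Type*} {b : HilbertBasis ι ℂ L2} {E : ι → ℝ}
    (hb : ∀ n, (b n, (E n : ℂ) • b n) ∈ deltaGraph g) {f w : L2} :
    (f, w) ∈ deltaGraph g ↔ ∀ n, inner ℂ (b n) w = E n * inner ℂ (b n) f := by
  constructor
  · intro h n
    rw [deltaGraph_symm (hb n) h, inner_smul_left, Complex.conj_ofReal]
  · intro h
    obtain ⟨T, -, hT⟩ := exists_resolvent hg
    -- Domain membership comes from the range of the resolvent: the coefficients determine `T (w +
    -- f)` by symmetry of `T`, and the pair built from it lies in the graph.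
    have h1 : T (w + f) = f := by
      refine b.ext_inner fun n => ?_
      have h2 : T (((1 + E n : ℝ) : ℂ) • b n) = b n := by
        have := resolvent_apply hg hT (hb n)
        rw [← this]
        congr 1
        rw [this]
        push_cast
        rw [add_smul, one_smul, add_comm]
      have h3 : inner ℂ (T (((1 + E n : ℝ) : ℂ) • b n)) (w + f)
          = inner ℂ (((1 + E n : ℝ) : ℂ) • b n) (T (w + f)) := resolvent_isSymmetric hT _ _
      rw [h2, inner_add_right, h n, inner_smul_left, Complex.conj_ofReal] at h3
      have h4 : ((1 + E n : ℝ) : ℂ) ≠ 0 := by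
        intro h0
        rw [h0, zero_smul, map_zero] at h2
        exact b.orthonormal.ne_zero n h2.symm
      refine mul_left_cancel₀ h4 ?_
      rw [← h3]
      push_cast
      ring
    have h2 := hT (w + f)
    rwa [h1, add_sub_cancel_right] at h2

/-! ### The unitary group: existence and uniqueness -/

theorem _root_.HilbertBasis.hasSum_norm_sq {ι H : Type*} [NormedAddCommGroup H]
    [InnerProductSpace ℂ H] (b : HilbertBasis ι ℂ H) (x : H) :
    HasSum (fun i => ‖inner ℂ (b i) x‖ ^ 2) (‖x‖ ^ 2) := by
  have h := Complex.hasSum_re (b.hasSum_inner_mul_inner x x)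
  convert h using 1
  · ext i
    rw [← inner_conj_symm x, Complex.conj_mul', ← Complex.ofReal_pow, Complex.ofReal_re]
  · rw [inner_self_eq_norm_sq_to_K]
    simp [← Complex.ofReal_pow]

/-- Dominated convergence of the coefficients in a Hilbert basis implies convergence in norm. -/
theorem _root_.HilbertBasis.tendsto_of_dominated {ι H α : Type*} [NormedAddCommGroup H]
    [InnerProductSpace ℂ H] (b : HilbertBasis ι ℂ H) {l : Filter α} [l.NeBot] {F : α → H} {y z : H}
    (hF : ∀ i, Tendsto (fun a => inner ℂ (b i) (F a)) l (𝓝 (inner ℂ (b i) y)))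
    (hz : ∀ a i, ‖inner ℂ (b i) (F a)‖ ≤ ‖inner ℂ (b i) z‖) : Tendsto F l (𝓝 y) := by
  have hy : ∀ i, ‖inner ℂ (b i) y‖ ≤ ‖inner ℂ (b i) z‖ := fun i =>
    le_of_tendsto (hF i).norm (Eventually.of_forall fun a => hz a i)
  have h1 : Tendsto (fun a => ∑' i, ‖inner ℂ (b i) (F a - y)‖ ^ 2) l (𝓝 (∑' _ : ι, (0 : ℝ))) := by
    refine tendsto_tsum_of_dominated_convergence
      (bound := fun i => 4 * ‖inner ℂ (b i) z‖ ^ 2)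
      ((b.hasSum_norm_sq z).summable.mul_left 4) (fun i => ?_)
      (Eventually.of_forall fun a i => ?_)
    · have h2 := ((hF i).sub_const (inner ℂ (b i) y)).norm.pow 2
      simpa [inner_sub_right] using h2
    · rw [Real.norm_of_nonneg (by positivity), inner_sub_right]
      have h3 := (norm_sub_le (inner ℂ (b i) (F a)) (inner ℂ (b i) y)).trans
        (add_le_add (hz a i) (hy i))
      nlinarith [norm_nonneg (inner ℂ (b i) (F a) - inner ℂ (b i) y)]
  simp only [(b.hasSum_norm_sq _).tsum_eq, tsum_zero] at h1
  rw [tendsto_iff_norm_sub_tendsto_zero]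
  have h4 := h1.sqrt
  simpa using h4

/-- The unitary operator which is diagonal in a Hilbert basis. -/
theorem _root_.HilbertBasis.exists_unitary_multiplier {ι H : Type*} [NormedAddCommGroup H]
    [InnerProductSpace ℂ H] [CompleteSpace H] (b : HilbertBasis ι ℂ H) {m : ι → ℂ}
    (hm : ∀ i, ‖m i‖ = 1) :
    ∃ U : H ≃ₗᵢ[ℂ] H, ∀ i f, inner ℂ (b i) (U f) = m i * inner ℂ (b i) f := by
  have hmc : ∀ i, starRingEnd ℂ (m i) * m i = 1 := fun i => by
    rw [Complex.conj_mul', hm]; simp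
  have ho : Orthonormal ℂ fun i => m i • b i := by
    classical
    rw [orthonormal_iff_ite]
    intro i j
    rw [inner_smul_left, inner_smul_right, orthonormal_iff_ite.1 b.orthonormal]
    split_ifs with h
    · rw [h, mul_one, hmc]
    · simp
  have hbot : (Submodule.span ℂ (range fun i => m i • b i))ᗮ = ⊥ := by
    rw [Submodule.eq_bot_iff]
    intro f hf
    refine b.ext_inner fun i => ?_
    have h1 := (Submodule.mem_orthogonal _ _).1 hf _ (Submodule.subset_span ⟨i, rfl⟩)
    rw [inner_smul_left] at h1
    rw [inner_zero_right]
    refine (mul_eq_zero.1 h1).resolve_left fun h2 => ?_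
    have h3 := hmc i
    rw [h2, zero_mul] at h3
    exact zero_ne_one h3
  -- The unitary is the change of basis sending `b i` to the rotated vector `m i • b i`.
  let c := HilbertBasis.mkOfOrthogonalEqBot ho hbot
  refine ⟨b.repr.trans c.repr.symm, fun i f => ?_⟩
  have h1 : inner ℂ (c i) (c.repr.symm (b.repr f)) = inner ℂ (b i) f := by
    rw [← c.repr_apply_apply, LinearIsometryEquiv.apply_symm_apply, b.repr_apply_apply]
  have h2 : c i = m i • b i := by
    simp only [c, HilbertBasis.coe_mkOfOrthogonalEqBot]
  rw [h2, inner_smul_left] at h1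
  rw [LinearIsometryEquiv.trans_apply, ← h1, ← mul_assoc, mul_comm (m i), hmc, one_mul]

/-- The phase factor of an eigenvector with eigenvalue `E` at time `t`. -/
def phase (E t : ℝ) : ℂ := Complex.exp (Complex.I * (E * t : ℝ))

theorem norm_phase (E t : ℝ) : ‖phase E t‖ = 1 := Complex.norm_exp_I_mul_ofReal _

theorem phase_add (E s t : ℝ) : phase E (s + t) = phase E s * phase E t := by
  unfold phase
  rw [← Complex.exp_add]
  congr 1
  push_cast
  ring

theorem phase_zero (E : ℝ) : phase E 0 = 1 := by simp [phase]

theorem hasDerivAt_phase (E t : ℝ) :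
    HasDerivAt (phase E) (Complex.I * E * phase E t) t := by
  have h1 : HasDerivAt (fun t : ℝ => Complex.I * ((E * t : ℝ) : ℂ)) (Complex.I * E) t := by
    have := (((hasDerivAt_id t).const_mul E).ofReal_comp).const_mul Complex.I
    simpa using this
  have h2 := h1.cexp
  rw [mul_comm (Complex.exp _)] at h2
  exact h2

theorem continuous_phase (E : ℝ) : Continuous (phase E) :=
  continuous_iff_continuousAt.2 fun t => (hasDerivAt_phase E t).continuousAt

theorem norm_phase_sub_one_le (E t : ℝ) : ‖phase E t - 1‖ ≤ |E * t| :=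
  Real.norm_exp_I_mul_ofReal_sub_one_le

/-- The Hamiltonian generates a unitary group. -/
theorem exists_isUnitaryGroupOf {g : ℝ} (hg : 0 < g) :
    ∃ U, IsUnitaryGroupOf (deltaHamiltonian g) U := by
  obtain ⟨b, E, hb⟩ := exists_hilbertBasis_deltaGraph hg
  choose U hU using fun t : ℝ => b.exists_unitary_multiplier (m := fun n => phase (E n) t)
    fun n => norm_phase _ _
  refine ⟨U, fun s t f => ?_, fun f => ?_, fun f w => ?_⟩
  · refine b.ext_inner fun n => ?_
    rw [hU, hU, hU, phase_add, mul_assoc]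
  · refine continuous_iff_continuousAt.2 fun s => ?_
    refine b.tendsto_of_dominated (z := f) (fun n => ?_) fun t n => ?_
    · simp only [hU]
      exact ((continuous_phase (E n)).tendsto s).mul_const _
    · rw [hU, norm_mul, norm_phase, one_mul]
  · rw [deltaHamiltonian_graph, mem_deltaGraph_iff hg hb]
    constructor
    · intro h
      rw [hasDerivAt_iff_tendsto_slope_zero]
      -- Since `|exp (iEt) - 1| ≤ |Et|`, the difference quotients have coefficients bounded by those
      -- of `w`.
      refine b.tendsto_of_dominated (z := w) (fun n => ?_) fun t n => ?_
      · have h1 := hasDerivAt_iff_tendsto_slope_zero.1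
          ((hasDerivAt_phase (E n) 0).mul_const (inner ℂ (b n) f))
        convert h1 using 2 with t
        · rw [inner_smul_right_eq_smul, inner_sub_right, hU, hU]
        · rw [inner_smul_right, h n, phase_zero]
          ring
      · rw [inner_smul_right_eq_smul, inner_sub_right, hU, hU, zero_add, phase_zero, ← sub_mul,
          norm_smul, norm_mul, h n, norm_mul, Complex.norm_real, ← mul_assoc]
        refine mul_le_mul_of_nonneg_right ?_ (norm_nonneg _)
        -- The domination is required for every `t`; at `t = 0` the quotient is `0` because `0⁻¹ =
        -- 0`.
        rcases eq_or_ne t 0 with rfl | ht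
        · simp
        · rw [norm_inv, inv_mul_le_iff₀ (norm_pos_iff.2 ht)]
          refine (norm_phase_sub_one_le _ _).trans_eq ?_
          rw [abs_mul, mul_comm]
          rfl
    · intro h n
      have h1 := ((innerSL ℂ (b n)).restrictScalars ℝ).hasFDerivAt.comp_hasDerivAt (0 : ℝ) h
      have h2 : HasDerivAt (fun t => phase (E n) t * inner ℂ (b n) f)
          (inner ℂ (b n) (Complex.I • w)) 0 :=
        h1.congr_of_eventuallyEq (Eventually.of_forall fun t => (hU t n f).symm)
      have h3 := h2.unique ((hasDerivAt_phase (E n) 0).mul_const _)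
      rw [inner_smul_right, phase_zero, mul_one, mul_assoc] at h3
      exact mul_left_cancel₀ Complex.I_ne_zero h3

theorem IsUnitaryGroupOf.apply_zero {A : L2 →ₗ.[ℂ] L2} {U : ℝ → (L2 ≃ₗᵢ[ℂ] L2)}
    (hU : IsUnitaryGroupOf A U) (f : L2) : U 0 f = f := by
  have h := hU.1 0 0 f
  rw [add_zero] at h
  exact ((U 0).injective h).symm

/-- Eigenvectors evolve by a phase. -/
theorem IsUnitaryGroupOf.apply_eigenvector {A : L2 →ₗ.[ℂ] L2} {U : ℝ → (L2 ≃ₗᵢ[ℂ] L2)}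
    (hU : IsUnitaryGroupOf A U) {E : ℝ} {x : L2} (hx : (x, (E : ℂ) • x) ∈ A.graph) (t : ℝ) :
    U t x = phase E t • x := by
  have h0 := (hU.2.2 _ _).1 hx
  -- The group law carries the derivative at time zero to time `s`.
  have h1 : ∀ s, HasDerivAt (fun t => U t x) ((Complex.I * E) • U s x) s := fun s => by
    have h2 : HasDerivAt (fun r => U (r - s) x) (Complex.I • (E : ℂ) • x) s := by
      rw [← sub_self s] at h0
      exact h0.comp_sub_const s s
    have h3 := (((U s).toContinuousLinearEquiv :
      L2 →L[ℂ] L2).restrictScalars ℝ).hasFDerivAt.comp_hasDerivAt s h2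
    have h4 : U s (Complex.I • (E : ℂ) • x) = (Complex.I * E) • U s x := by
      rw [smul_smul, map_smul]
    rw [← h4]
    refine h3.congr_of_eventuallyEq (Eventually.of_forall fun r => ?_)
    have := hU.1 s (r - s) x
    rw [add_sub_cancel] at this
    exact this
  have h2 : ∀ s, HasDerivAt (fun t => phase (-E) t • U t x) 0 s := fun s => by
    have h3 := (hasDerivAt_phase (-E) s).smul (h1 s)
    have h4 : phase (-E) s * (Complex.I * E) + Complex.I * ((-E : ℝ) : ℂ) * phase (-E) s = 0 := by
      push_cast
      ring
    rwa [smul_smul, ← add_smul, h4, zero_smul] at h3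
  have h3 := is_const_of_deriv_eq_zero (fun s => (h2 s).differentiableAt)
    (fun s => (h2 s).deriv) t 0
  simp only [phase_zero, one_smul, hU.apply_zero] at h3
  have h4 : phase E t * phase (-E) t = 1 := by
    unfold phase
    rw [← Complex.exp_add]
    convert Complex.exp_zero using 2
    push_cast
    ring
  conv_rhs => rw [← h3, smul_smul, h4, one_smul]

/-- The generator fixes the phases on an eigenbasis, and continuity of each unitary extends the
agreement to all vectors. -/
theorem IsUnitaryGroupOf.unique {g : ℝ} (hg : 0 < g) {U U' : ℝ → (L2 ≃ₗᵢ[ℂ] L2)}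
    (hU : IsUnitaryGroupOf (deltaHamiltonian g) U)
    (hU' : IsUnitaryGroupOf (deltaHamiltonian g) U') : U' = U := by
  obtain ⟨b, E, hb⟩ := exists_hilbertBasis_deltaGraph hg
  simp only [← deltaHamiltonian_graph] at hb
  ext1 t
  ext1 f
  have h1 : HasSum (fun n => U t (b.repr f n • b n)) (U t f) :=
    (U t).toContinuousLinearEquiv.toContinuousLinearMap.hasSum (b.hasSum_repr f)
  have h2 : HasSum (fun n => U' t (b.repr f n • b n)) (U' t f) :=
    (U' t).toContinuousLinearEquiv.toContinuousLinearMap.hasSum (b.hasSum_repr f)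
  have e : (fun n => U t (b.repr f n • b n)) = fun n => U' t (b.repr f n • b n) :=
    funext fun n => by
      rw [map_smul, map_smul, hU'.apply_eigenvector (hb n), hU.apply_eigenvector (hb n)]
  rw [e] at h1
  exact h2.unique h1

/-! ### Spectral expansion of the commutator -/

theorem app_momentum {f w : L2} (h : (f, w) ∈ momentumGraph) : app momentum f = w := by
  rw [← momentum_graph] at h
  have hf : f ∈ momentum.domain := LinearPMap.mem_domain_of_mem_graph h
  rw [app, dif_pos hf]
  exact momentum.mem_graph_snd_inj (momentum.mem_graph ⟨f, hf⟩) h rfl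

theorem phase_im (E t : ℝ) : (phase E t).im = Real.sin (E * t) := by
  rw [phase, mul_comm, Complex.exp_ofReal_mul_I_im]

/-- The commutator expectation in terms of an expansion of `p f` into eigenvectors. -/
theorem hasSum_commutatorExpectation {g : ℝ} {U : ℝ → (L2 ≃ₗᵢ[ℂ] L2)}
    (hU : IsUnitaryGroupOf (deltaHamiltonian g) U) {f P : L2} {E₀ : ℝ}
    (hf : (f, (E₀ : ℂ) • f) ∈ deltaGraph g) (hP : (f, P) ∈ momentumGraph) {ι : Type*}
    {x : ι → L2} {E : ι → ℝ} (hx : ∀ i, (x i, (E i : ℂ) • x i) ∈ deltaGraph g)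
    (hs : HasSum (fun i => inner ℂ (x i) P • x i) P) (t : ℝ) :
    ∃ r : ℝ, commutatorExpectation momentum U f t = r ∧
      HasSum (fun i => -2 * ‖inner ℂ (x i) P‖ ^ 2 * Real.sin ((E i - E₀) * t)) r := by
  rw [← deltaHamiltonian_graph] at hf
  simp only [← deltaHamiltonian_graph] at hx
  -- The evolved eigenvector is a multiple of `f`, so it stays in the momentum domain and `app`
  -- never takes its junk value here.
  have h1 : app momentum (U (-t) f) = phase E₀ (-t) • P := by
    rw [hU.apply_eigenvector hf]
    exact app_momentum (momentumGraph.smul_mem _ hP)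
  set z : ℂ := inner ℂ P (U t (phase E₀ (-t) • P)) with hz
  have h2 : HasSum (fun i => ((‖inner ℂ (x i) P‖ ^ 2 : ℝ) : ℂ) * phase (E i - E₀) t) z := by
    have h3 : HasSum (fun i => inner ℂ P (U t (phase E₀ (-t) • inner ℂ (x i) P • x i))) z :=
      (innerSL ℂ P).hasSum ((U t).toContinuousLinearEquiv.toContinuousLinearMap.hasSum
        (hs.const_smul (phase E₀ (-t))))
    have e : (fun i => ((‖inner ℂ (x i) P‖ ^ 2 : ℝ) : ℂ) * phase (E i - E₀) t)
        = fun i => inner ℂ P (U t (phase E₀ (-t) • inner ℂ (x i) P • x i)) := by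
      ext1 i
      have h5 : phase (E i - E₀) t = phase E₀ (-t) * phase (E i) t := by
        unfold phase
        rw [← Complex.exp_add]
        congr 1
        push_cast
        ring
      rw [map_smul, map_smul, hU.apply_eigenvector (hx i), inner_smul_right, inner_smul_right,
        inner_smul_right, ← inner_conj_symm P, h5]
      have h6 := Complex.mul_conj' (inner ℂ (x i) P)
      push_cast
      linear_combination (-phase E₀ (-t) * phase (E i) t) * h6
    rw [e]
    exact h3
  refine ⟨-2 * z.im, ?_, ?_⟩
  · rw [commutatorExpectation, h1, app_momentum hP, ← hz, ← inner_conj_symm _ P, ← hz,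
      Complex.sub_conj]
    push_cast
    linear_combination (2 * (z.im : ℂ)) * Complex.I_sq
  · have h3 := (Complex.hasSum_im h2).mul_left (-2)
    have e : (fun i => -2 * ‖inner ℂ (x i) P‖ ^ 2 * Real.sin ((E i - E₀) * t))
        = fun i => -2 * (((‖inner ℂ (x i) P‖ ^ 2 : ℝ) : ℂ) * phase (E i - E₀) t).im := by
      ext1 i
      rw [Complex.im_ofReal_mul, phase_im]
      ring
    rw [e]
    exact h3

/-! ### Odd eigenfunctions -/

theorem ofContinuous_congr {u w : ℝ → ℂ} (h : u = w) (hu : Continuous u) (hw : Continuous w) :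
    ofContinuous u hu = ofContinuous w hw := by
  subst h; rfl

theorem oddState_eq (j : ℕ) :
    oddState j = (-(Complex.I * √2 / 2)) • (wave j - wave (-(j : ℤ))) := by
  have h : (fun x : ℝ => ((√2 * Real.sin (2 * Real.pi * j * x) : ℝ) : ℂ)) =
      fun x : ℝ => (-(Complex.I * √2 / 2)) *
        (Complex.exp (freq j * x) - Complex.exp (freq (-(j : ℤ)) * x)) := by
    ext1 x
    push_cast
    rw [Complex.sin]
    have e1 : freq j * x = 2 * Real.pi * j * x * Complex.I := by
      unfold freq; push_cast; ring
    have e2 : freq (-(j : ℤ)) * x = -(2 * Real.pi * j * x) * Complex.I := by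
      unfold freq; push_cast; ring
    rw [e1, e2]
    ring
  rw [oddState, ofContinuous_congr h _ (by fun_prop)]
  rfl

theorem freq_neg (n : ℤ) : freq (-n) = -freq n := by
  unfold freq; push_cast; ring

theorem isPeriodicH1_oddState (j : ℕ) :
    ∃ u, u 0 = 0 ∧ IsPeriodicH1 u (oddState j)
      ((-(Complex.I * √2 / 2) * freq j) • (wave j + wave (-(j : ℤ)))) := by
  have h := ((isPeriodicH1_wave j).add ((isPeriodicH1_wave (-(j : ℤ))).smul (-1))).smul
    (-(Complex.I * √2 / 2))
  have e2 : -(Complex.I * √2 / 2) • (freq j • wave j + (-1 : ℂ) • freq (-(j : ℤ)) • wave (-(j : ℤ)))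
      = (-(Complex.I * √2 / 2) * freq j) • (wave j + wave (-(j : ℤ))) := by
    rw [freq_neg, smul_smul (-1 : ℂ), neg_mul_neg, one_mul, ← smul_add, smul_smul]
  rw [e2, neg_one_smul ℂ (wave (-(j : ℤ))), ← sub_eq_add_neg (wave j), ← oddState_eq] at h
  exact ⟨_, by simp, h⟩

theorem inner_oddState (j : ℕ) (f : L2) : inner ℂ (oddState j) f
    = Complex.I * √2 / 2 * (inner ℂ (wave j) f - inner ℂ (wave (-(j : ℤ))) f) := by
  rw [oddState_eq, inner_smul_left, inner_sub_left]
  congr 1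
  simp [map_ofNat, neg_div]

theorem sqrt_two_mul_self : (√2 : ℂ) * √2 = 2 := by
  rw [← Complex.ofReal_mul, Real.mul_self_sqrt (by norm_num)]
  norm_num

theorem orthonormal_oddState : Orthonormal ℂ fun j : ℕ => oddState (j + 1) := by
  rw [orthonormal_iff_ite]
  intro i j
  rw [inner_oddState, oddState_eq, inner_smul_right, inner_smul_right, inner_sub_right,
    inner_sub_right]
  simp only [orthonormal_iff_ite.1 orthonormal_wave]
  rw [if_neg (show ((i + 1 : ℕ) : ℤ) ≠ -((j + 1 : ℕ) : ℤ) by push_cast; omega),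
    if_neg (show -((i + 1 : ℕ) : ℤ) ≠ ((j + 1 : ℕ) : ℤ) by push_cast; omega)]
  have e : ∀ p : Prop, ∀ [Decidable p], (Complex.I * √2 / 2 * (-(Complex.I * √2 / 2) *
      ((if p then (1 : ℂ) else 0) - 0) - -(Complex.I * √2 / 2) * (0 - if p then (1 : ℂ) else 0)))
      = if p then 1 else 0 := by
    intro p _
    split_ifs
    · linear_combination (-1 / 2 * (√2 : ℂ) * √2) * Complex.I_sq + 1 / 2 * sqrt_two_mul_self
    · simp
  have e1 : (((i + 1 : ℕ) : ℤ) = ((j + 1 : ℕ) : ℤ)) ↔ i = j := by push_cast; omega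
  have e2 : (-((i + 1 : ℕ) : ℤ) = -((j + 1 : ℕ) : ℤ)) ↔ i = j := by push_cast; omega
  simp only [e1, e2]
  exact e (i = j)

/-- The energy of the odd state with index `j`. -/
def oddEnergy (j : ℕ) : ℝ := 4 * Real.pi ^ 2 * (j : ℝ) ^ 2

theorem freq_natCast_sq (j : ℕ) : freq j ^ 2 = -(oddEnergy j : ℂ) := by
  rw [freq_sq, oddEnergy]; push_cast; rfl

/-- Sines vanish at the origin and do not feel the delta interaction, so they remain free
eigenfunctions. -/
theorem oddState_mem_deltaGraph (g : ℝ) (j : ℕ) :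
    (oddState j, (oddEnergy j : ℂ) • oddState j) ∈ deltaGraph g := by
  obtain ⟨u, hu0, hu⟩ := isPeriodicH1_oddState j
  refine ⟨u, _, hu, fun a φ η h => ?_⟩
  have h1 : ∀ n, inner ℂ η (wave n) = -freq n * inner ℂ φ (wave n) := fun n => by
    rw [← inner_conj_symm η, h.inner_wave, map_mul, conj_freq, inner_conj_symm]
  rw [hu0, inner_smul_right, inner_add_right, h1, h1, oddState_eq, inner_smul_right,
    inner_smul_right, inner_sub_right, freq_neg]
  linear_combination (Complex.I * √2 / 2) *
    (inner ℂ φ (wave j) - inner ℂ φ (wave (-(j : ℤ)))) * freq_natCast_sq j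

theorem oddState_mem_momentumGraph (j : ℕ) : (oddState j, (-Complex.I) •
    ((-(Complex.I * √2 / 2) * freq j) • (wave j + wave (-(j : ℤ))))) ∈ momentumGraph := by
  obtain ⟨u, -, hu⟩ := isPeriodicH1_oddState j
  exact ⟨u, _, hu, rfl⟩

theorem measurePreserving_neg_cell : MeasurePreserving (fun x : ℝ => -x) cellMeasure cellMeasure := by
  have h := (Measure.measurePreserving_neg (volume : Measure ℝ)).restrict_preimage
    (measurableSet_Ioo (a := (-1 / 2 : ℝ)) (b := 1 / 2))
  have e : (Neg.neg ⁻¹' Ioo (-1 / 2 : ℝ) (1 / 2)) = Ioo (-1 / 2 : ℝ) (1 / 2) := by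
    ext x
    simp only [mem_preimage, mem_Ioo]
    constructor <;> rintro ⟨h1, h2⟩ <;> constructor <;> linarith
  rw [e] at h
  exact h

theorem isOdd_oddState (j : ℕ) : IsOdd (oddState j) := by
  have h : oddState j =ᵐ[cellMeasure] fun x => ((√2 * Real.sin (2 * Real.pi * j * x) : ℝ) : ℂ) :=
    coeFn_ofContinuous _
  have h' := measurePreserving_neg_cell.quasiMeasurePreserving.ae h
  filter_upwards [h, h'] with x h1 h2
  rw [h1, h2, mul_neg, Real.sin_neg, mul_neg, Complex.ofReal_neg]

theorem IsOdd.inner_wave {f : L2} (hf : IsOdd f) (n : ℤ) :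
    inner ℂ (wave (-n)) f = -inner ℂ (wave n) f := by
  rw [inner_wave_eq, inner_wave_eq, ← intervalIntegral.integral_neg]
  have h1 := intervalIntegral.integral_comp_neg (a := (-1 / 2 : ℝ)) (b := 1 / 2)
    (fun x : ℝ => Complex.exp (-(freq (-n) * x)) * f x)
  rw [show (-(1 / 2) : ℝ) = -1 / 2 by norm_num, show (-(-1 / 2) : ℝ) = 1 / 2 by norm_num] at h1
  rw [← h1]
  refine intervalIntegral.integral_congr_ae ?_
  have h2 : ∀ᵐ x ∂volume.restrict (Ioc (-1 / 2 : ℝ) (1 / 2)), f (-x) = -f x := by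
    rw [← restrict_Ioo_eq_restrict_Ioc]
    exact hf
  rw [ae_restrict_iff' measurableSet_Ioc] at h2
  filter_upwards [h2] with x hx hxI
  rw [uIoc_of_le (by norm_num)] at hxI
  rw [hx hxI, freq_neg]
  push_cast
  rw [neg_mul_neg]
  ring

/-- The sine series of an odd function. -/
theorem hasSum_oddState {f : L2} (hf : ∀ n, inner ℂ (wave (-n)) f = -inner ℂ (wave n) f) :
    HasSum (fun j : ℕ => inner ℂ (oddState (j + 1)) f • oddState (j + 1)) f := by
  have h0 : inner ℂ (wave 0) f = 0 := by
    have := hf 0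
    rw [neg_zero] at this
    exact self_eq_neg.1 this
  have h1 : HasSum (fun n : ℤ => inner ℂ (wave n) f • wave n) f := by
    have := waveBasis.hasSum_repr f
    simpa only [waveBasis.repr_apply_apply, coe_waveBasis] using this
  -- Pairing `n` with `-n` counts the zero mode twice; it vanishes by antisymmetry, and the sum can
  -- then start at `1`.
  have h2 := h1.nat_add_neg
  rw [h0, zero_smul, add_zero] at h2
  rw [← hasSum_nat_add_iff' 1] at h2
  have h3 : ∀ j : ℕ, inner ℂ (wave j) f • wave j + inner ℂ (wave (-(j : ℤ))) f • wave (-(j : ℤ))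
      = inner ℂ (oddState j) f • oddState j := fun j => by
    rw [inner_oddState, hf, oddState_eq, smul_smul]
    have : Complex.I * √2 / 2 * (inner ℂ (wave j) f - -inner ℂ (wave j) f) *
        -(Complex.I * √2 / 2) = inner ℂ (wave j) f := by
      linear_combination (-1 / 2 * (√2 : ℂ) * √2 * inner ℂ (wave j) f) * Complex.I_sq
        + 1 / 2 * inner ℂ (wave j) f * sqrt_two_mul_self
    rw [this, smul_sub, neg_smul, sub_eq_add_neg]
  simp only [h3] at h2
  rw [Finset.sum_range_one, inner_oddState] at h2
  simpa [h0] using h2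

theorem oddEnergy_injective {i j : ℕ} (h : oddEnergy i = oddEnergy j) : i = j := by
  unfold oddEnergy at h
  have h1 := mul_left_cancel₀ (show (4 * Real.pi ^ 2 : ℝ) ≠ 0 by positivity) h
  have h2 := (sq_eq_sq₀ (Nat.cast_nonneg i) (Nat.cast_nonneg j)).1 h1
  exact_mod_cast h2

theorem deltaGraph_inner_eq_zero {g E E' : ℝ} {f f' : L2} (h : (f, (E : ℂ) • f) ∈ deltaGraph g)
    (h' : (f', (E' : ℂ) • f') ∈ deltaGraph g) (hE : E ≠ E') : inner ℂ f f' = 0 := by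
  have h1 := deltaGraph_symm h h'
  rw [inner_smul_right, inner_smul_left, Complex.conj_ofReal] at h1
  have h2 : ((E' - E : ℝ) : ℂ) * inner ℂ f f' = 0 := by push_cast; linear_combination h1
  refine (mul_eq_zero.1 h2).resolve_left ?_
  exact Complex.ofReal_ne_zero.2 <| sub_ne_zero.2 hE.symm

/-- In the sine series of `f` only terms of energy `E` survive, and the odd energies are pairwise
distinct. -/
theorem exists_eq_smul_oddState {g E : ℝ} {f : L2} (hf : IsOdd f) (h0 : f ≠ 0)
    (h : (f, (E : ℂ) • f) ∈ deltaGraph g) :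
    ∃ j : ℕ, 1 ≤ j ∧ E = oddEnergy j ∧ ∃ c : ℂ, f = c • oddState j := by
  have hs := hasSum_oddState hf.inner_wave
  have h1 : ∃ j : ℕ, inner ℂ (oddState (j + 1)) f ≠ 0 := by
    by_contra! hc
    simp only [hc, zero_smul] at hs
    exact h0 (hs.unique hasSum_zero)
  obtain ⟨j, hj⟩ := h1
  have hE : oddEnergy (j + 1) = E := by
    by_contra hE
    exact hj (deltaGraph_inner_eq_zero (oddState_mem_deltaGraph g _) h hE)
  refine ⟨j + 1, by omega, hE.symm, _, hs.unique (hasSum_single j fun i hi => ?_)⟩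
  rw [deltaGraph_inner_eq_zero (oddState_mem_deltaGraph g _) h, zero_smul]
  intro h2
  have := oddEnergy_injective (h2.trans hE.symm)
  omega

/-! ### Quantization condition and ground state -/

/-- The Fourier coefficients of an eigenfunction. -/
theorem exists_inner_wave_eigenvector {g E : ℝ} {f : L2} (h : (f, (E : ℂ) • f) ∈ deltaGraph g) :
    ∃ κ : ℂ, ∀ n : ℤ, ((E - 4 * Real.pi ^ 2 * (n : ℝ) ^ 2 : ℝ) : ℂ) * inner ℂ (wave n) f = κ := by
  obtain ⟨u, v, hu, e⟩ := h
  refine ⟨g * u 0, fun n => ?_⟩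
  have h1 := e _ _ _ (isPeriodicH1_wave n)
  rw [inner_smul_left, inner_smul_right, hu.inner_wave, conj_freq] at h1
  simp only [Complex.ofReal_zero, mul_zero, Complex.exp_zero, map_one, one_mul] at h1
  have h2 := freq_sq n
  push_cast at h2 ⊢
  linear_combination -h1 - inner ℂ (wave n) f * h2

/-- The quantization condition has a unique solution, and it lies in `(0, π)`. -/
theorem exists_unique_quantization {g : ℝ} (hg : 0 < g) : ∃ β ∈ Ioo 0 Real.pi,
    β * Real.tan (β / 2) = g / 2 ∧
      ∀ β' ∈ Ioo 0 (2 * Real.pi), β' * Real.tan (β' / 2) = g / 2 → β' = β := by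
  have hpi := Real.pi_pos
  have hcos : ∀ x ∈ Ioo 0 Real.pi, 0 < Real.cos (x / 2) := fun x hx =>
    Real.cos_pos_of_mem_Ioo ⟨by linarith [hx.1], by linarith [hx.2]⟩
  -- Multiplying by the cosine removes the pole of the tangent at `β = π`, so the intermediate value
  -- theorem applies on the closed interval.
  obtain ⟨β, hβ, hβ0⟩ : ∃ β ∈ Ioo 0 Real.pi,
      β * Real.sin (β / 2) - g / 2 * Real.cos (β / 2) = 0 := by
    have h := intermediate_value_Ioo hpi.le
      (f := fun β => β * Real.sin (β / 2) - g / 2 * Real.cos (β / 2)) (by fun_prop)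
    have h0 : (0 : ℝ) ∈ Ioo ((0 : ℝ) * Real.sin (0 / 2) - g / 2 * Real.cos (0 / 2))
        (Real.pi * Real.sin (Real.pi / 2) - g / 2 * Real.cos (Real.pi / 2)) := by
      simp [hg, hpi]
    exact h h0
  have htan : β * Real.tan (β / 2) = g / 2 := by
    rw [Real.tan_eq_sin_div_cos, ← mul_div_assoc, div_eq_iff (hcos β hβ).ne']
    linarith
  have hmono : ∀ x ∈ Ioo 0 Real.pi, ∀ y ∈ Ioo 0 Real.pi, x < y →
      x * Real.tan (x / 2) < y * Real.tan (y / 2) := fun x hx y hy hxy => by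
    have h1 : Real.tan (x / 2) < Real.tan (y / 2) :=
      Real.tan_lt_tan_of_lt_of_lt_pi_div_two (by linarith [hx.1]) (by linarith [hy.2])
        (by linarith)
    have h2 : 0 < Real.tan (x / 2) :=
      Real.tan_pos_of_pos_of_lt_pi_div_two (by linarith [hx.1]) (by linarith [hx.2])
    exact mul_lt_mul hxy h1.le h2 hy.1.le
  refine ⟨β, hβ, htan, fun β' hβ' h' => ?_⟩
  -- From `π` on, the tangent of the half angle is nonpositive, including at `π` itself, where
  -- division by zero makes it `0`.
  have hlt : β' < Real.pi := by
    by_contra! hle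
    have h1 : Real.cos (β' / 2) ≤ 0 :=
      Real.cos_nonpos_of_pi_div_two_le_of_le (by linarith) (by linarith [hβ'.2])
    have h2 : 0 ≤ Real.sin (β' / 2) :=
      Real.sin_nonneg_of_nonneg_of_le_pi (by linarith [hβ'.1]) (by linarith [hβ'.2])
    have h3 : Real.tan (β' / 2) ≤ 0 := by
      rw [Real.tan_eq_sin_div_cos]
      exact div_nonpos_of_nonneg_of_nonpos h2 h1
    nlinarith [hβ'.1]
  rcases lt_trichotomy β' β with h | h | h
  · exact absurd (hmono _ ⟨hβ'.1, hlt⟩ _ hβ h) (by rw [h', htan]; exact lt_irrefl _)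
  · exact h
  · exact absurd (hmono _ hβ _ ⟨hβ'.1, hlt⟩ h) (by rw [h', htan]; exact lt_irrefl _)

/-- The quantization condition is exactly `k' (1/2) = 0`, and the sine coefficient is chosen so that
the jump `2 k' 0` equals `g C`. -/
theorem exists_isPeriodicH1_evenState {g β : ℝ} (C : ℝ) (hβ : β ∈ Ioo 0 Real.pi)
    (hq : β * Real.tan (β / 2) = g / 2) :
    ∃ u V, u 0 = (C : ℂ) ∧ IsPeriodicH1 u (evenState g β C) V ∧ ∀ a φ η, IsPeriodicH1 a φ η →
      inner ℂ η V = (β ^ 2 : ℝ) * inner ℂ φ (evenState g β C) - g * C * starRingEnd ℂ (a 0) := by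
  have hb : β ≠ 0 := hβ.1.ne'
  set k : ℝ → ℝ := fun x => C * (Real.cos (β * x) + g / (2 * β) * Real.sin (β * x)) with hk
  set k' : ℝ → ℝ := fun x => C * (-β * Real.sin (β * x) + g / 2 * Real.cos (β * x)) with hk'
  have hlin : ∀ x, HasDerivAt (fun x => β * x) β x := fun x => by
    simpa using (hasDerivAt_id x).const_mul β
  have h1 : ∀ x, HasDerivAt k (k' x) x := fun x => by
    have := ((hlin x).cos.add ((hlin x).sin.const_mul (g / (2 * β)))).const_mul C
    refine this.congr_deriv ?_
    simp only [hk']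
    field_simp
  have h2 : ∀ x, HasDerivAt k' (-(β ^ 2) * k x) x := fun x => by
    have := (((hlin x).sin.const_mul (-β)).add ((hlin x).cos.const_mul (g / 2))).const_mul C
    refine this.congr_deriv ?_
    simp only [hk]
    field_simp
    ring
  have hcos : 0 < Real.cos (β / 2) :=
    Real.cos_pos_of_mem_Ioo ⟨by linarith [hβ.1, Real.pi_pos], by linarith [hβ.2]⟩
  have h0 : k' (1 / 2) = 0 := by
    rw [Real.tan_eq_sin_div_cos, ← mul_div_assoc, div_eq_iff hcos.ne'] at hq
    simp only [hk', mul_one_div]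
    linear_combination -C * hq
  have hc : Continuous fun x : ℝ => ((k |x| : ℝ) : ℂ) := by fun_prop
  obtain ⟨V, hV, h⟩ := exists_isPeriodicH1_comp_abs h1 h2 h0 hc
  have e : evenState g β C = ofContinuous _ hc := by
    refine ofContinuous_congr (funext fun x => ?_) _ _
    simp only [hk]
    rcases abs_cases x with ⟨hx, -⟩ | ⟨hx, -⟩ <;> rw [hx]
    rw [mul_neg β x, Real.cos_neg]
  rw [e]
  refine ⟨_, V, by simp [hk], hV, fun a φ η ha => ?_⟩
  rw [h a φ η ha]
  simp only [hk', mul_zero, Real.sin_zero, Real.cos_zero]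
  push_cast
  ring

theorem evenState_mem_deltaGraph {g β : ℝ} (C : ℝ) (hβ : β ∈ Ioo 0 Real.pi)
    (hq : β * Real.tan (β / 2) = g / 2) :
    (evenState g β C, ((β ^ 2 : ℝ) : ℂ) • evenState g β C) ∈ deltaGraph g := by
  obtain ⟨u, V, hu0, hu, h⟩ := exists_isPeriodicH1_evenState C hβ hq
  refine ⟨u, V, hu, fun a φ η ha => ?_⟩
  rw [h a φ η ha, hu0, inner_smul_right]
  ring

theorem sq_sub_ne_zero {β : ℝ} (hβ : β ∈ Ioo 0 Real.pi) (n : ℤ) :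
    β ^ 2 - 4 * Real.pi ^ 2 * (n : ℝ) ^ 2 ≠ 0 := by
  rcases eq_or_ne n 0 with rfl | hn
  · simpa using hβ.1.ne'
  · have h1 : (1 : ℝ) ≤ (n : ℝ) ^ 2 := by
      have : 0 < n ^ 2 := sq_pos_of_ne_zero hn
      have : 1 ≤ n ^ 2 := this
      exact_mod_cast this
    nlinarith [hβ.1, hβ.2, Real.pi_pos]

/-- Every plane wave equals `1` at the origin, so the delta term contributes the same constant `g C`
to each mode. -/
theorem inner_wave_evenState {g β : ℝ} (C : ℝ) (hβ : β ∈ Ioo 0 Real.pi)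
    (hq : β * Real.tan (β / 2) = g / 2) (n : ℤ) :
    inner ℂ (wave n) (evenState g β C)
      = ((g * C / (β ^ 2 - 4 * Real.pi ^ 2 * (n : ℝ) ^ 2) : ℝ) : ℂ) := by
  obtain ⟨u, V, hu0, hu, h⟩ := exists_isPeriodicH1_evenState C hβ hq
  have h1 := h _ _ _ (isPeriodicH1_wave n)
  rw [inner_smul_left, hu.inner_wave, conj_freq] at h1
  simp only [Complex.ofReal_zero, mul_zero, Complex.exp_zero, map_one, mul_one] at h1
  have h2 := freq_sq n
  have h3 : ((β ^ 2 - 4 * Real.pi ^ 2 * (n : ℝ) ^ 2 : ℝ) : ℂ) ≠ 0 :=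
    Complex.ofReal_ne_zero.2 (sq_sub_ne_zero hβ n)
  rw [Complex.ofReal_div, eq_div_iff h3]
  push_cast at h1 h2 ⊢
  linear_combination -h1 - inner ℂ (wave n) (evenState g β C) * h2

theorem evenState_eq_smul (g β C : ℝ) : evenState g β C = (C : ℂ) • evenState g β 1 := by
  have h : (fun x : ℝ => ((C * (Real.cos (β * x) + g / (2 * β) * Real.sin (β * |x|)) : ℝ) : ℂ))
      = fun x : ℝ => (C : ℂ) *
        ((1 * (Real.cos (β * x) + g / (2 * β) * Real.sin (β * |x|)) : ℝ) : ℂ) := by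
    ext1 x
    rw [one_mul, Complex.ofReal_mul]
  rw [evenState, ofContinuous_congr h _ (by fun_prop)]
  rfl

theorem exists_norm_evenState {g β : ℝ} (hβ : β ∈ Ioo 0 Real.pi)
    (hq : β * Real.tan (β / 2) = g / 2) : ∃ C, 0 < C ∧ ‖evenState g β C‖ = 1 := by
  have h0 : evenState g β 1 ≠ 0 := fun h => by
    obtain ⟨u, V, hu0, hu, -⟩ := exists_isPeriodicH1_evenState 1 hβ hq
    rw [h] at hu
    have := hu.eq_zero.1 (show (0 : ℝ) ∈ Icc (-1 / 2 : ℝ) (1 / 2) by norm_num)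
    rw [hu0] at this
    simp at this
  have h1 := norm_pos_iff.2 h0
  refine ⟨‖evenState g β 1‖⁻¹, by positivity, ?_⟩
  rw [evenState_eq_smul, norm_smul, Complex.norm_real, norm_inv, norm_norm,
    inv_mul_cancel₀ h1.ne']

/-- The lowest even state is non-degenerate. -/
theorem eq_smul_evenState {g β C : ℝ} (hg : 0 < g) (hC : 0 < C) (hβ : β ∈ Ioo 0 Real.pi)
    (hq : β * Real.tan (β / 2) = g / 2) {f : L2}
    (hf : (f, ((β ^ 2 : ℝ) : ℂ) • f) ∈ deltaGraph g) : ∃ c : ℂ, f = c • evenState g β C := by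
  obtain ⟨κ, hκ⟩ := exists_inner_wave_eigenvector hf
  refine ⟨κ / (g * C), waveBasis.ext_inner fun n => ?_⟩
  have h3 : ((β ^ 2 - 4 * Real.pi ^ 2 * (n : ℝ) ^ 2 : ℝ) : ℂ) ≠ 0 :=
    Complex.ofReal_ne_zero.2 (sq_sub_ne_zero hβ n)
  have h4 : (g : ℂ) ≠ 0 := Complex.ofReal_ne_zero.2 hg.ne'
  have h5 : (C : ℂ) ≠ 0 := Complex.ofReal_ne_zero.2 hC.ne'
  rw [coe_waveBasis, inner_smul_right, inner_wave_evenState C hβ hq]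
  refine mul_left_cancel₀ h3 ?_
  rw [hκ n, Complex.ofReal_div]
  push_cast at h3 ⊢
  field_simp

/-- Every eigenvalue is at least `β ^ 2`. -/
theorem sq_le_of_eigenvector {g β E : ℝ} (hg : 0 < g) (hβ : β ∈ Ioo 0 Real.pi)
    (hq : β * Real.tan (β / 2) = g / 2) {f : L2} (h0 : f ≠ 0)
    (hf : (f, (E : ℂ) • f) ∈ deltaGraph g) : β ^ 2 ≤ E := by
  by_contra! hlt
  have hE : 0 < E := by
    by_contra! hE
    exact h0 (deltaGraph_eq_zero_of_nonpos hg hE hf)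
  obtain ⟨κ, hκ⟩ := exists_inner_wave_eigenvector hf
  -- These are the Parseval terms of the inner product with the even state, up to `g κ`. Both
  -- factors are positive at `n = 0` and negative elsewhere, as `E < β² < 4π²`.
  set p : ℤ → ℝ := fun n =>
    1 / ((β ^ 2 - 4 * Real.pi ^ 2 * (n : ℝ) ^ 2) * (E - 4 * Real.pi ^ 2 * (n : ℝ) ^ 2)) with hp
  have hpos : ∀ n, 0 < p n := fun n => by
    refine one_div_pos.2 ?_
    rcases eq_or_ne n 0 with rfl | hn
    · have := hβ.1
      simp only [Int.cast_zero, ne_eq, OfNat.ofNat_ne_zero, not_false_eq_true, zero_pow, mul_zero,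
        sub_zero]
      positivity
    · have h1 : (1 : ℝ) ≤ (n : ℝ) ^ 2 := by
        have : 0 < n ^ 2 := sq_pos_of_ne_zero hn
        have : 1 ≤ n ^ 2 := this
        exact_mod_cast this
      have h2 : β ^ 2 < 4 * Real.pi ^ 2 * (n : ℝ) ^ 2 := by
        nlinarith [hβ.1, hβ.2, Real.pi_pos]
      exact mul_pos_of_neg_of_neg (by linarith) (by linarith)
  have hne : ∀ n : ℤ, E - 4 * Real.pi ^ 2 * (n : ℝ) ^ 2 ≠ 0 := fun n h => by
    have := hpos n
    simp [hp, h] at this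
  have horth : inner ℂ (evenState g β 1) f = 0 :=
    deltaGraph_inner_eq_zero (evenState_mem_deltaGraph 1 hβ hq) hf hlt.ne'
  have hsum := waveBasis.hasSum_inner_mul_inner (evenState g β 1) f
  rw [horth] at hsum
  have hterm : ∀ n, inner ℂ (evenState g β 1) (waveBasis n) * inner ℂ (waveBasis n) f
      = (g * κ) * (p n : ℂ) := fun n => by
    rw [coe_waveBasis, ← inner_conj_symm (evenState g β 1), inner_wave_evenState 1 hβ hq,
      Complex.conj_ofReal, ← hκ n]
    simp only [hp]
    have h1 : ((β ^ 2 - 4 * Real.pi ^ 2 * (n : ℝ) ^ 2 : ℝ) : ℂ) ≠ 0 :=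
      Complex.ofReal_ne_zero.2 (sq_sub_ne_zero hβ n)
    have h2 : ((E - 4 * Real.pi ^ 2 * (n : ℝ) ^ 2 : ℝ) : ℂ) ≠ 0 :=
      Complex.ofReal_ne_zero.2 (hne n)
    push_cast at h1 h2 ⊢
    field_simp
  simp only [hterm] at hsum
  have hκ0 : κ ≠ 0 := by
    rintro rfl
    refine h0 (eq_zero_of_inner_wave fun n => ?_)
    exact (mul_eq_zero.1 (hκ n)).resolve_left (Complex.ofReal_ne_zero.2 (hne n))
  have hgκ : (g * κ : ℂ) ≠ 0 := mul_ne_zero (Complex.ofReal_ne_zero.2 hg.ne') hκ0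
  have h1 := hsum.mul_left (g * κ : ℂ)⁻¹
  simp only [inv_mul_cancel_left₀ hgκ, mul_zero] at h1
  have h2 : HasSum p 0 := by simpa using Complex.hasSum_re h1
  have h3 := (hasSum_zero_iff_of_nonneg fun n => (hpos n).le).1 h2
  exact (hpos 0).ne' (congrFun h3 0)

/-- Minimality is termwise in an eigenbasis, since no eigenvalue lies below `β ^ 2`. -/
theorem isGroundState_evenState {g β C : ℝ} (hg : 0 < g) (hβ : β ∈ Ioo 0 Real.pi)
    (hq : β * Real.tan (β / 2) = g / 2) (h0 : evenState g β C ≠ 0) :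
    IsGroundState (deltaHamiltonian g) (β ^ 2) (evenState g β C) := by
  refine ⟨⟨h0, ?_⟩, fun φ => ?_⟩
  · rw [deltaHamiltonian_graph]
    exact evenState_mem_deltaGraph C hβ hq
  · obtain ⟨b, E, hb⟩ := exists_hilbertBasis_deltaGraph hg
    have hφ : ((φ : L2), deltaHamiltonian g φ) ∈ deltaGraph g := by
      rw [← deltaHamiltonian_graph]
      exact (deltaHamiltonian g).mem_graph φ
    have h1 := (mem_deltaGraph_iff hg hb).1 hφ
    have h2 := Complex.hasSum_re (b.hasSum_inner_mul_inner (φ : L2) (deltaHamiltonian g φ))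
    refine hasSum_le (fun n => ?_) ((b.hasSum_norm_sq (φ : L2)).mul_left (β ^ 2)) h2
    have h3 : inner ℂ (φ : L2) (b n) * inner ℂ (b n) (deltaHamiltonian g φ)
        = ((E n * ‖inner ℂ (b n) (φ : L2)‖ ^ 2 : ℝ) : ℂ) := by
      rw [h1, ← inner_conj_symm (φ : L2)]
      have := Complex.conj_mul' (inner ℂ (b n) (φ : L2))
      push_cast
      linear_combination (E n : ℂ) * this
    rw [h3, Complex.ofReal_re]
    exact mul_le_mul_of_nonneg_right
      (sq_le_of_eigenvector hg hβ hq (b.orthonormal.ne_zero n) (hb n)) (by positivity)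

/-! ### Momentum matrix elements -/

/-- The derivative of the even state: its momentum image and the matrix elements. -/
theorem exists_momentum_evenState {g β : ℝ} (C : ℝ) (hβ : β ∈ Ioo 0 Real.pi)
    (hq : β * Real.tan (β / 2) = g / 2) :
    ∃ P : L2, (evenState g β C, P) ∈ momentumGraph ∧
      (∀ n, inner ℂ (wave (-n)) P = -inner ℂ (wave n) P) ∧
      ∀ j : ℕ, inner ℂ (oddState j) P =
        -(Complex.I * ((√2 * g * C * (2 * Real.pi * j) / (oddEnergy j - β ^ 2) : ℝ) : ℂ)) := by
  obtain ⟨u, V, -, hu, -⟩ := exists_isPeriodicH1_evenState C hβ hq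
  have hodd : ∀ n, inner ℂ (wave (-n)) ((-Complex.I) • V) = -inner ℂ (wave n) ((-Complex.I) • V) :=
    fun n => by
    rw [inner_smul_right, inner_smul_right, hu.inner_wave, hu.inner_wave,
      inner_wave_evenState C hβ hq, inner_wave_evenState C hβ hq, freq_neg, Int.cast_neg, neg_sq]
    ring
  refine ⟨(-Complex.I) • V, ⟨u, V, hu, rfl⟩, hodd, fun j => ?_⟩
  rw [inner_oddState, hodd, inner_smul_right, hu.inner_wave, inner_wave_evenState C hβ hq, freq]
  have h1 : ((β ^ 2 - oddEnergy j : ℝ) : ℂ) ≠ 0 :=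
    Complex.ofReal_ne_zero.2 (by have := sq_sub_ne_zero hβ j; simpa [oddEnergy] using this)
  have h2 : ((oddEnergy j - β ^ 2 : ℝ) : ℂ) ≠ 0 := by
    rw [← neg_ne_zero, ← Complex.ofReal_neg, neg_sub]; exact h1
  rw [show β ^ 2 - 4 * Real.pi ^ 2 * ((j : ℤ) : ℝ) ^ 2 = β ^ 2 - oddEnergy j by
    simp [oddEnergy]]
  rw [show oddEnergy j - β ^ 2 = -(β ^ 2 - oddEnergy j) by ring, Complex.ofReal_div,
    Complex.ofReal_div, Complex.ofReal_neg]
  push_cast at h1 ⊢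
  field_simp
  linear_combination (-2 * j * g * C : ℂ) * Complex.I_sq

/-- Symmetry of the periodic momentum operator, which moves it from the odd state onto `f`. -/
theorem app_momentum_oddState_inner {f P : L2} (h : (f, P) ∈ momentumGraph) (j : ℕ) :
    inner ℂ (app momentum (oddState j)) f = inner ℂ (oddState j) P := by
  obtain ⟨u, v, hu, e⟩ := h
  simp only at e hu
  rw [app_momentum (oddState_mem_momentumGraph j), inner_oddState, e, inner_smul_left,
    inner_smul_left, inner_add_left, inner_smul_right, inner_smul_right, hu.inner_wave,
    hu.inner_wave, freq_neg, map_mul, conj_freq]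
  have : starRingEnd ℂ (-(Complex.I * √2 / 2)) = Complex.I * √2 / 2 := by
    simp [map_ofNat, neg_div]
  rw [this, map_neg, Complex.conj_I]
  ring

/-! ### The Riemann function at the origin -/

theorem summable_one_div_succ_sq : Summable fun j : ℕ => 1 / (j + 1 : ℝ) ^ 2 := by
  have h := (summable_nat_add_iff 1).2 (Real.summable_one_div_nat_pow.2 one_lt_two)
  simpa using h

theorem oddEnergy_succ (j : ℕ) : oddEnergy (j + 1) = 4 * Real.pi ^ 2 * (j + 1 : ℝ) ^ 2 := by
  simp [oddEnergy]

theorem oddEnergy_succ_pos (j : ℕ) : 0 < oddEnergy (j + 1) := by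
  rw [oddEnergy_succ]; positivity

theorem riemannFunction_eq (t : ℝ) :
    riemannFunction t = ∑' j : ℕ, Real.sin (oddEnergy (j + 1) * t) / (j + 1 : ℝ) ^ 2 := by
  simp only [oddEnergy_succ, riemannFunction]

theorem hasDerivAt_const_mul_sin (c a t : ℝ) :
    HasDerivAt (fun t => c * Real.sin (a * t)) (c * (a * Real.cos (a * t))) t := by
  have h := (((hasDerivAt_id t).const_mul a).sin).const_mul c
  refine h.congr_deriv ?_
  simp only [id]
  ring

/-- The primitive of the Riemann function. -/
theorem hasDerivAt_primitive_riemannFunction (t : ℝ) :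
    HasDerivAt (fun t => ∑' j : ℕ, (1 - Real.cos (oddEnergy (j + 1) * t)) /
      (oddEnergy (j + 1) * (j + 1 : ℝ) ^ 2)) (riemannFunction t) t := by
  rw [riemannFunction_eq]
  refine hasDerivAt_tsum (u := fun j : ℕ => 1 / (j + 1 : ℝ) ^ 2) (y₀ := 0)
    (g' := fun j t => Real.sin (oddEnergy (j + 1) * t) / (j + 1 : ℝ) ^ 2)
    summable_one_div_succ_sq (fun j y => ?_) (fun j y => ?_) ?_ t
  · have h := (((hasDerivAt_id y).const_mul (oddEnergy (j + 1))).cos.const_sub 1).div_const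
      (oddEnergy (j + 1) * (j + 1 : ℝ) ^ 2)
    refine h.congr_deriv ?_
    have := (oddEnergy_succ_pos j).ne'
    simp only [id]
    field_simp
  · rw [Real.norm_eq_abs, abs_div, abs_of_pos (show (0 : ℝ) < (j + 1 : ℝ) ^ 2 by positivity)]
    exact div_le_div_of_nonneg_right (Real.abs_sin_le_one _) (by positivity)
  · simp

theorem summable_primitive_riemannFunction (t : ℝ) :
    Summable fun j : ℕ => (1 - Real.cos (oddEnergy (j + 1) * t)) /
      (oddEnergy (j + 1) * (j + 1 : ℝ) ^ 2) := by
  refine Summable.of_nonneg_of_le (fun j => ?_) (fun j => ?_)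
    (summable_one_div_succ_sq.mul_left 2)
  · have := oddEnergy_succ_pos j
    exact div_nonneg (by linarith [Real.cos_le_one (oddEnergy (j + 1) * t)]) (by positivity)
  · have h1 : 1 ≤ oddEnergy (j + 1) := by
      rw [oddEnergy_succ]
      have h2 : (1 : ℝ) ≤ (j + 1 : ℝ) ^ 2 := by
        have : (0 : ℝ) ≤ j := Nat.cast_nonneg j
        nlinarith
      nlinarith [Real.pi_gt_three]
    rw [mul_one_div]
    have h3 : (0 : ℝ) < (j + 1 : ℝ) ^ 2 := by positivity
    refine div_le_div₀ (by norm_num) (by linarith [Real.neg_one_le_cos (oddEnergy (j + 1) * t)])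
      h3 ?_
    nlinarith

theorem riemannFunction_zero : riemannFunction 0 = 0 := by
  simp [riemannFunction]

/-- The primitive `Q` has nonnegative terms, so partial sums bound it from below; this avoids
controlling the oscillating tail of the sine series. -/
theorem not_differentiableAt_riemannFunction : ¬ DifferentiableAt ℝ riemannFunction 0 := by
  intro hd
  set Q : ℝ → ℝ := fun t => ∑' j : ℕ, (1 - Real.cos (oddEnergy (j + 1) * t)) /
      (oddEnergy (j + 1) * (j + 1 : ℝ) ^ 2) with hQ
  obtain ⟨M, hM⟩ := hd.isBigO_sub.bound
  simp only [riemannFunction_zero, sub_zero] at hM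
  obtain ⟨ε, hε, hball⟩ := Metric.eventually_nhds_iff.1 hM
  have hQ0 : Q 0 = 0 := by simp [hQ]
  have hup : ∀ δ, 0 < δ → δ < ε → Q δ ≤ |M| * δ ^ 2 := fun δ h0 h1 => by
    obtain ⟨c, hc, hc'⟩ := exists_hasDerivAt_eq_slope Q riemannFunction h0
      (fun t _ => (hasDerivAt_primitive_riemannFunction t).continuousAt.continuousWithinAt)
      fun t _ => hasDerivAt_primitive_riemannFunction t
    rw [hQ0, sub_zero, sub_zero, eq_div_iff h0.ne'] at hc'
    rw [← hc']
    have h2 := hball (y := c) (by rw [Real.dist_eq, sub_zero, abs_of_pos hc.1]; linarith [hc.2])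
    rw [Real.norm_eq_abs, Real.norm_eq_abs, abs_of_pos hc.1] at h2
    have h3 : riemannFunction c ≤ |M| * δ :=
      (le_abs_self _).trans (h2.trans (mul_le_mul (le_abs_self M) hc.2.le hc.1.le (abs_nonneg M)))
    nlinarith
  -- At this time the first `N` angles are at most `1`, so `1 - cos x ≥ 2x²/π²` applies; the powers
  -- of `j` cancel and each term is at least `8 δ²`.
  have hlow : ∀ N : ℕ, 0 < N → 8 * N * (1 / (4 * Real.pi ^ 2 * (N : ℝ) ^ 2)) ^ 2
      ≤ Q (1 / (4 * Real.pi ^ 2 * (N : ℝ) ^ 2)) := fun N hN => by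
    set δ : ℝ := 1 / (4 * Real.pi ^ 2 * (N : ℝ) ^ 2) with hδ
    have hN' : (0 : ℝ) < N := by exact_mod_cast hN
    have hδ0 : 0 < δ := by positivity
    have h1 : ∑ j ∈ Finset.range N, 8 * δ ^ 2 ≤ ∑ j ∈ Finset.range N,
        (1 - Real.cos (oddEnergy (j + 1) * δ)) / (oddEnergy (j + 1) * (j + 1 : ℝ) ^ 2) := by
      refine Finset.sum_le_sum fun j hj => ?_
      have hj' : (j + 1 : ℝ) ≤ N := by exact_mod_cast Finset.mem_range.1 hj
      have hx0 : 0 ≤ oddEnergy (j + 1) * δ := (mul_pos (oddEnergy_succ_pos j) hδ0).le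
      have hx1 : oddEnergy (j + 1) * δ ≤ 1 := by
        rw [oddEnergy_succ, hδ, mul_one_div, div_le_one (by positivity)]
        gcongr
      have hcos := Real.cos_le_one_sub_mul_cos_sq (x := oddEnergy (j + 1) * δ) (by
        rw [abs_of_nonneg hx0]; linarith [Real.pi_gt_three])
      rw [le_div_iff₀ (mul_pos (oddEnergy_succ_pos j) (by positivity))]
      refine le_trans (le_of_eq ?_) (by linarith : 2 / Real.pi ^ 2 * (oddEnergy (j + 1) * δ) ^ 2
        ≤ 1 - Real.cos (oddEnergy (j + 1) * δ))
      rw [oddEnergy_succ]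
      field_simp
      ring
    have h2 := (summable_primitive_riemannFunction δ).sum_le_tsum (Finset.range N) fun j _ =>
      div_nonneg (by linarith [Real.cos_le_one (oddEnergy (j + 1) * δ)])
        (mul_pos (oddEnergy_succ_pos j) (by positivity)).le
    refine le_trans (le_of_eq ?_) (h1.trans h2)
    rw [Finset.sum_const, Finset.card_range, nsmul_eq_mul]
    ring
  obtain ⟨N, hN⟩ := exists_nat_gt (max 1 (max |M| (1 / ε)))
  have hN1 : (1 : ℝ) < N := (le_max_left _ _).trans_lt hN
  have hN2 : |M| < N := ((le_max_left _ _).trans (le_max_right _ _)).trans_lt hN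
  have hN3 : 1 / ε < N := ((le_max_right _ _).trans (le_max_right _ _)).trans_lt hN
  have hNpos : 0 < N := by
    have : (0 : ℝ) < N := by linarith
    exact_mod_cast this
  have hδ0 : 0 < 1 / (4 * Real.pi ^ 2 * (N : ℝ) ^ 2) := by positivity
  have hδε : 1 / (4 * Real.pi ^ 2 * (N : ℝ) ^ 2) < ε := by
    rw [div_lt_comm₀ (by positivity) hε]
    refine hN3.trans_le ?_
    have : (1 : ℝ) ≤ 4 * Real.pi ^ 2 := by nlinarith [Real.pi_gt_three]
    nlinarith
  have h1 := (hlow N hNpos).trans (hup _ hδ0 hδε)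
  have h2 : 8 * (N : ℝ) ≤ |M| := le_of_mul_le_mul_right h1 (by positivity)
  linarith

/-! ### Regularity of sine series -/

/-- As `f` vanishes at `x`, the slope of the product is the slope of `f` times `h t`. Hence series
that are merely continuous may be multiplied by `sin (ω t)` or `cos (ω t) - 1`. -/
theorem hasDerivAt_mul_of_continuousAt {f h : ℝ → ℝ} {f' x : ℝ} (hf : HasDerivAt f f' x)
    (h0 : f x = 0) (hh : ContinuousAt h x) : HasDerivAt (fun t => f t * h t) (f' * h x) x := by
  rw [hasDerivAt_iff_tendsto_slope] at hf ⊢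
  have h1 := hf.mul (hh.tendsto.mono_left nhdsWithin_le_nhds)
  refine h1.congr fun t => ?_
  rw [slope_def_field, slope_def_field, h0]
  ring

/-- Interpolation between the bounds `|x|` and `1`. -/
theorem abs_sin_le_rpow (x : ℝ) {α : ℝ} (h0 : 0 ≤ α) (h1 : α ≤ 1) : |Real.sin x| ≤ |x| ^ α := by
  rcases le_total |x| 1 with h | h
  · refine Real.abs_sin_le_abs.trans ?_
    conv_lhs => rw [← Real.rpow_one |x|]
    rcases (abs_nonneg x).eq_or_lt with h2 | h2
    · rw [← h2, Real.zero_rpow one_ne_zero]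
      exact Real.rpow_nonneg le_rfl _
    · exact Real.rpow_le_rpow_of_exponent_ge h2 h h1
  · exact (Real.abs_sin_le_one x).trans (Real.one_le_rpow h h0)

theorem summable_mul_of_abs_le_one {m e : ℕ → ℝ} {B : ℝ}
    (hm : ∀ j, |m j| ≤ B * (1 / (j + 1 : ℝ) ^ 2)) (he : ∀ j, |e j| ≤ 1) :
    Summable fun j => m j * e j := by
  refine Summable.of_norm_bounded (summable_one_div_succ_sq.mul_left B) fun j => ?_
  rw [Real.norm_eq_abs, abs_mul]
  exact (mul_le_of_le_one_right (abs_nonneg _) (he j)).trans (hm j)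

theorem continuous_tsum_mul {m : ℕ → ℝ} {e : ℕ → ℝ → ℝ} {B : ℝ}
    (hm : ∀ j, |m j| ≤ B * (1 / (j + 1 : ℝ) ^ 2)) (he : ∀ j t, |e j t| ≤ 1)
    (hc : ∀ j, Continuous (e j)) : Continuous fun t => ∑' j, m j * e j t := by
  refine continuous_tsum (fun j => (hc j).const_mul _) (summable_one_div_succ_sq.mul_left B)
    fun j t => ?_
  rw [Real.norm_eq_abs, abs_mul]
  exact (mul_le_of_le_one_right (abs_nonneg _) (he j t)).trans (hm j)

/-- A sine series with shifted frequencies and coefficients close to `κ / j²` is a multiple of the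
Riemann function up to a function that is differentiable at `0`. -/
theorem exists_differentiableAt_remainder {m : ℕ → ℝ} {κ ω B B' : ℝ}
    (hB : ∀ j, |m j| ≤ B * (1 / (j + 1 : ℝ) ^ 2))
    (hB' : ∀ j, oddEnergy (j + 1) * |m j - κ / (j + 1 : ℝ) ^ 2| ≤ B' * (1 / (j + 1 : ℝ) ^ 2)) :
    ∃ F : ℝ → ℝ, DifferentiableAt ℝ F 0 ∧ ∀ t,
      ∑' j, -2 * m j * Real.sin ((oddEnergy (j + 1) - ω) * t) = -2 * κ * riemannFunction t + F t := by
  set ρ : ℕ → ℝ := fun j => m j - κ / (j + 1 : ℝ) ^ 2 with hρ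
  set S₁ : ℝ → ℝ := fun t => ∑' j, ρ j * Real.sin (oddEnergy (j + 1) * t)
  set S₂ : ℝ → ℝ := fun t => ∑' j, m j * Real.cos (oddEnergy (j + 1) * t)
  have hκ : ∀ j : ℕ, |κ / (j + 1 : ℝ) ^ 2| ≤ |κ| * (1 / (j + 1 : ℝ) ^ 2) := fun j => by
    rw [abs_div, abs_of_pos (show (0 : ℝ) < (j + 1 : ℝ) ^ 2 by positivity), mul_one_div]
  have hρB : ∀ j, |ρ j| ≤ (B + |κ|) * (1 / (j + 1 : ℝ) ^ 2) := fun j => by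
    rw [add_mul]
    exact (abs_sub _ _).trans (add_le_add (hB j) (hκ j))
  have hR : ∀ t, riemannFunction t * κ
      = ∑' j : ℕ, κ / (j + 1 : ℝ) ^ 2 * Real.sin (oddEnergy (j + 1) * t) := fun t => by
    rw [riemannFunction_eq, ← tsum_mul_right]
    refine tsum_congr fun j => ?_
    ring
  have hRc : Continuous fun t => riemannFunction t * κ := by
    simp only [hR]
    exact continuous_tsum_mul hκ (fun j t => Real.abs_sin_le_one _) fun j => by fun_prop
  have hS₁ : DifferentiableAt ℝ S₁ 0 := by
    refine (hasDerivAt_tsum (u := fun j : ℕ => B' * (1 / (j + 1 : ℝ) ^ 2)) (y₀ := 0)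
      (g := fun j t => ρ j * Real.sin (oddEnergy (j + 1) * t))
      (summable_one_div_succ_sq.mul_left B') (fun j y => hasDerivAt_const_mul_sin _ _ _)
      (fun j y => ?_) ?_ 0).differentiableAt
    · rw [Real.norm_eq_abs, abs_mul, abs_mul, abs_of_pos (oddEnergy_succ_pos j)]
      refine le_trans ?_ (hB' j)
      rw [mul_left_comm]
      exact mul_le_mul_of_nonneg_left (mul_le_of_le_one_right (abs_nonneg _)
        (Real.abs_cos_le_one _)) (oddEnergy_succ_pos j).le
    · simp
  have hS₂ : Continuous S₂ :=
    continuous_tsum_mul hB (fun j t => Real.abs_cos_le_one _) fun j => by fun_prop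
  have hcos : HasDerivAt (fun t => Real.cos (ω * t) - 1) 0 0 := by
    have h := (((hasDerivAt_id (0 : ℝ)).const_mul ω).cos).sub_const 1
    refine h.congr_deriv ?_
    simp
  have hsin : HasDerivAt (fun t => Real.sin (ω * t)) ω 0 := by
    have h := ((hasDerivAt_id (0 : ℝ)).const_mul ω).sin
    refine h.congr_deriv ?_
    simp
  have d1 := (hasDerivAt_mul_of_continuousAt hcos (by simp) hRc.continuousAt).differentiableAt
  have d2 := (hasDerivAt_mul_of_continuousAt hsin (by simp) hS₂.continuousAt).differentiableAt
  have d3 : DifferentiableAt ℝ (fun t => Real.cos (ω * t)) 0 := by fun_prop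
  -- Obtained from the sine subtraction formula, with `m j` split as `ρ j + κ / (j + 1)²` in the
  -- `cos (ω t)` part and one multiple of the Riemann function taken out.
  refine ⟨fun t => -2 * (Real.cos (ω * t) * S₁ t + (Real.cos (ω * t) - 1) * (riemannFunction t * κ)
    - Real.sin (ω * t) * S₂ t), (((d3.mul hS₁).add d1).sub d2).const_mul _, fun t => ?_⟩
  have s1 := summable_mul_of_abs_le_one hρB fun j => Real.abs_sin_le_one (oddEnergy (j + 1) * t)
  have s2 := summable_mul_of_abs_le_one hB fun j => Real.abs_cos_le_one (oddEnergy (j + 1) * t)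
  have s3 := summable_mul_of_abs_le_one hκ fun j => Real.abs_sin_le_one (oddEnergy (j + 1) * t)
  have key : HasSum (fun j => -2 * m j * Real.sin ((oddEnergy (j + 1) - ω) * t))
      (-2 * (Real.cos (ω * t) * (S₁ t + riemannFunction t * κ) - Real.sin (ω * t) * S₂ t)) := by
    rw [hR]
    have h := (((s1.hasSum.add s3.hasSum).mul_left (Real.cos (ω * t))).sub
      (s2.hasSum.mul_left (Real.sin (ω * t)))).mul_left (-2)
    have e : (fun j => -2 * m j * Real.sin ((oddEnergy (j + 1) - ω) * t)) = fun j : ℕ =>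
        -2 * (Real.cos (ω * t) * (ρ j * Real.sin (oddEnergy (j + 1) * t)
          + κ / (j + 1 : ℝ) ^ 2 * Real.sin (oddEnergy (j + 1) * t))
          - Real.sin (ω * t) * (m j * Real.cos (oddEnergy (j + 1) * t))) := by
      ext1 j
      rw [sub_mul, Real.sin_sub]
      simp only [hρ]
      ring
    rw [e]
    exact h
  rw [key.tsum_eq]
  ring

/-- Hölder continuity of sine series with coefficients of order `1 / j²`. -/
theorem exists_holder_bound {m : ℕ → ℝ} {ω B α : ℝ} (hω : 0 ≤ ω) (hω' : ω ≤ 4 * Real.pi ^ 2)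
    (hB : ∀ j, |m j| ≤ B * (1 / (j + 1 : ℝ) ^ 2)) (h0 : 0 ≤ α) (h1 : α < 1 / 2) :
    ∃ M : ℝ, ∀ t, |∑' j, -2 * m j * Real.sin ((oddEnergy (j + 1) - ω) * t)| ≤ M * |t| ^ α := by
  have hB0 : 0 ≤ B := by
    have := (abs_nonneg _).trans (hB 0)
    simpa using this
  -- The frequency contributes growth of order `j ^ (2α)`; the exponent `2 - 2α` exceeds `1`
  -- precisely when `α < 1/2`.
  set b : ℕ → ℝ := fun j => 2 * B * (4 * Real.pi ^ 2) ^ α * (1 / (j + 1 : ℝ) ^ (2 - 2 * α)) with hb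
  have hs : Summable b := by
    refine Summable.mul_left _ ?_
    have h := (summable_nat_add_iff 1).2
      (Real.summable_one_div_nat_rpow.2 (show 1 < 2 - 2 * α by linarith))
    simpa using h
  refine ⟨∑' j, b j, fun t => ?_⟩
  have hle : ∀ j, ‖-2 * m j * Real.sin ((oddEnergy (j + 1) - ω) * t)‖ ≤ b j * |t| ^ α := fun j => by
    have hj : (0 : ℝ) < (j + 1 : ℝ) := by positivity
    have h2 : |oddEnergy (j + 1) - ω| ≤ 4 * Real.pi ^ 2 * (j + 1 : ℝ) ^ 2 := by
      rw [oddEnergy_succ, abs_of_nonneg, sub_le_self_iff]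
      · exact hω
      · have : (1 : ℝ) ≤ (j + 1 : ℝ) ^ 2 := by
          have : (0 : ℝ) ≤ j := Nat.cast_nonneg j
          nlinarith
        nlinarith [Real.pi_pos]
    have h3 : |Real.sin ((oddEnergy (j + 1) - ω) * t)|
        ≤ (4 * Real.pi ^ 2) ^ α * (j + 1 : ℝ) ^ (2 * α) * |t| ^ α := by
      refine (abs_sin_le_rpow _ h0 (by linarith)).trans ?_
      rw [abs_mul, Real.mul_rpow (abs_nonneg _) (abs_nonneg _)]
      refine mul_le_mul_of_nonneg_right ?_ (by positivity)
      refine (Real.rpow_le_rpow (abs_nonneg _) h2 h0).trans_eq ?_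
      rw [Real.mul_rpow (by positivity) (by positivity), Real.rpow_mul hj.le, Real.rpow_two]
    rw [Real.norm_eq_abs, abs_mul, abs_mul, abs_neg, abs_two]
    refine (mul_le_mul (mul_le_mul_of_nonneg_left (hB j) zero_le_two) h3 (abs_nonneg _)
      (by positivity)).trans_eq ?_
    simp only [hb]
    rw [Real.rpow_sub hj, Real.rpow_two]
    field_simp
  have hsum : Summable fun j => ‖-2 * m j * Real.sin ((oddEnergy (j + 1) - ω) * t)‖ :=
    Summable.of_nonneg_of_le (fun j => norm_nonneg _) hle (hs.mul_right _)
  rw [← tsum_mul_right]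
  exact (norm_tsum_le_tsum_norm hsum).trans (hsum.tsum_le_tsum hle (hs.mul_right _))

/-- A sine series is differentiable when the series of the absolute derivatives converges. -/
theorem differentiable_tsum_sin {m E : ℕ → ℝ} (h : Summable fun n => m n * E n) :
    Differentiable ℝ fun t => ∑' n, m n * Real.sin (E n * t) := by
  intro t
  refine (hasDerivAt_tsum (u := fun n => |m n * E n|) (y₀ := 0)
    (g := fun n t => m n * Real.sin (E n * t)) h.abs
    (fun n y => hasDerivAt_const_mul_sin _ _ _) (fun n y => ?_) ?_ t).differentiableAt
  · rw [← mul_assoc, Real.norm_eq_abs, abs_mul]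
    exact mul_le_of_le_one_right (abs_nonneg _) (Real.abs_cos_le_one _)
  · simp

/-! ### Asymptotics of the weights -/

theorem div_sub_sq_le {a ω : ℝ} (ha : 0 < a) (hω : 0 ≤ ω) (h : 4 * ω ≤ a) :
    a / (a - ω) ^ 2 ≤ 2 / a := by
  rw [div_le_div_iff₀ (by nlinarith) ha]
  nlinarith

theorem mul_abs_div_sub_sq_sub_le {a ω : ℝ} (ha : 0 < a) (hω : 0 ≤ ω) (h : 4 * ω ≤ a) :
    a * |a / (a - ω) ^ 2 - 1 / a| ≤ 4 * ω / a := by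
  have h1 : 0 < a - ω := by linarith
  have h2 : a / (a - ω) ^ 2 - 1 / a = ω * (2 * a - ω) / (a * (a - ω) ^ 2) := by
    field_simp
    ring
  rw [h2, abs_of_nonneg (div_nonneg (mul_nonneg hω (by linarith)) (by positivity)), ← mul_div_assoc,
    div_le_div_iff₀ (by positivity) ha]
  have h3 : (2 * a - ω) * a ≤ 4 * (a - ω) ^ 2 := by nlinarith
  calc a * (ω * (2 * a - ω)) * a = a * ω * ((2 * a - ω) * a) := by ring
    _ ≤ a * ω * (4 * (a - ω) ^ 2) := mul_le_mul_of_nonneg_left h3 (by positivity)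
    _ = _ := by ring

theorem four_mul_sq_le_oddEnergy {β : ℝ} (hβ : β ∈ Ioo 0 Real.pi) {j : ℕ} (hj : 1 ≤ j) :
    4 * β ^ 2 ≤ oddEnergy j := by
  have h1 : (1 : ℝ) ≤ (j : ℝ) ^ 2 := one_le_pow₀ (by exact_mod_cast hj)
  unfold oddEnergy
  nlinarith [hβ.1, hβ.2, Real.pi_pos]

/-- The weights of the odd states in the momentum image of the ground state. -/
theorem sq_matrixElement (g C β : ℝ) (j : ℕ) :
    (√2 * g * C * (2 * Real.pi * j) / (oddEnergy j - β ^ 2)) ^ 2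
      = 2 * (g * C) ^ 2 * (oddEnergy j / (oddEnergy j - β ^ 2) ^ 2) := by
  rw [div_pow, mul_pow, mul_pow, mul_pow, Real.sq_sqrt zero_le_two]
  simp only [oddEnergy]
  ring

/-- These are the size and remainder bounds needed for the sine series; the limiting weight is `2
(gC)² / oddEnergy`, whence `κ = (gC)² / (2π²)`. -/
theorem matrixElement_bounds (g C : ℝ) {β : ℝ} (hβ : β ∈ Ioo 0 Real.pi) (j : ℕ) :
    |2 * (g * C) ^ 2 * (oddEnergy (j + 1) / (oddEnergy (j + 1) - β ^ 2) ^ 2)|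
      ≤ (g * C) ^ 2 / Real.pi ^ 2 * (1 / (j + 1 : ℝ) ^ 2) ∧
    oddEnergy (j + 1) * |2 * (g * C) ^ 2 * (oddEnergy (j + 1) / (oddEnergy (j + 1) - β ^ 2) ^ 2)
      - (g * C) ^ 2 / (2 * Real.pi ^ 2) / (j + 1 : ℝ) ^ 2|
      ≤ 2 * (g * C) ^ 2 * β ^ 2 / Real.pi ^ 2 * (1 / (j + 1 : ℝ) ^ 2) := by
  have ha := oddEnergy_succ_pos j
  have h4 := four_mul_sq_le_oddEnergy hβ (show 1 ≤ j + 1 by omega)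
  have e1 : (g * C) ^ 2 / (2 * Real.pi ^ 2) / (j + 1 : ℝ) ^ 2
      = 2 * (g * C) ^ 2 * (1 / oddEnergy (j + 1)) := by
    rw [oddEnergy_succ]
    have := Real.pi_pos
    field_simp
    ring
  constructor
  · rw [abs_of_nonneg (by positivity)]
    refine (mul_le_mul_of_nonneg_left (div_sub_sq_le ha (sq_nonneg β) h4)
      (by positivity)).trans_eq ?_
    rw [oddEnergy_succ]
    have := Real.pi_pos
    field_simp
    ring
  · rw [e1, ← mul_sub, abs_mul, abs_of_nonneg (show 0 ≤ 2 * (g * C) ^ 2 by positivity),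
      mul_left_comm]
    refine (mul_le_mul_of_nonneg_left (mul_abs_div_sub_sq_sub_le ha (sq_nonneg β) h4)
      (by positivity)).trans_eq ?_
    rw [oddEnergy_succ]
    have := Real.pi_pos
    field_simp

theorem isBigO_matrixElement {g C β : ℝ} (hg : 0 < g) (hC : 0 < C) (hβ : β ∈ Ioo 0 Real.pi) :
    (fun j : ℕ => -(Complex.I *
        ((√2 * g * C * (2 * Real.pi * j) / (oddEnergy j - β ^ 2) : ℝ) : ℂ))
      - (-(Complex.I * C * g / (√2 * j * Real.pi)))) =O[atTop] fun j : ℕ => 1 / (j : ℝ) ^ 3 := by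
  refine Asymptotics.IsBigO.of_bound (√2 * g * C * β ^ 2 / (4 * Real.pi ^ 3)) ?_
  filter_upwards [eventually_ge_atTop 1] with j hj
  have hj' : (0 : ℝ) < j := by exact_mod_cast hj
  have hpi := Real.pi_pos
  have h4 := four_mul_sq_le_oddEnergy hβ hj
  have ha : 0 < oddEnergy j := by unfold oddEnergy; positivity
  have hs : (√2 : ℝ) ≠ 0 := by positivity
  have hd : 0 < oddEnergy j - β ^ 2 := by nlinarith [hβ.1]
  have h2 : (√2 : ℝ) ^ 2 = 2 := Real.sq_sqrt zero_le_two
  -- The leading term is the matrix element with `β²` dropped from the denominator, so the error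
  -- gains a factor `β² / (oddEnergy j - β²)`.
  have e1 : √2 * g * C * (2 * Real.pi * j) / (oddEnergy j - β ^ 2) - C * g / (√2 * j * Real.pi)
      = √2 * g * C * β ^ 2 / (2 * Real.pi * j * (oddEnergy j - β ^ 2)) := by
    obtain ⟨d, hd'⟩ : ∃ d, d = oddEnergy j - β ^ 2 := ⟨_, rfl⟩
    have h5 : β ^ 2 = 4 * Real.pi ^ 2 * (j : ℝ) ^ 2 - d := by rw [hd', oddEnergy]; ring
    rw [← hd'] at hd ⊢
    rw [h5]
    have := hd.ne'
    field_simp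
    rw [h2]
    ring
  have e2 : -(Complex.I * ((√2 * g * C * (2 * Real.pi * j) / (oddEnergy j - β ^ 2) : ℝ) : ℂ))
      - (-(Complex.I * C * g / (√2 * j * Real.pi))) = -Complex.I *
        ((√2 * g * C * (2 * Real.pi * j) / (oddEnergy j - β ^ 2) - C * g / (√2 * j * Real.pi) : ℝ) :
          ℂ) := by
    push_cast
    ring
  rw [e2, e1, norm_mul, norm_neg, Complex.norm_I, one_mul, Complex.norm_real,
    Real.norm_of_nonneg (by positivity), Real.norm_of_nonneg (by positivity), mul_one_div, div_div]
  refine div_le_div_of_nonneg_left (by positivity) (by positivity) ?_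
  have h6 : oddEnergy j / 2 ≤ oddEnergy j - β ^ 2 := by linarith [sq_nonneg β]
  calc 4 * Real.pi ^ 3 * (j : ℝ) ^ 3 = 2 * Real.pi * j * (oddEnergy j / 2) := by
        unfold oddEnergy; ring
    _ ≤ _ := mul_le_mul_of_nonneg_left h6 (by positivity)

end

end PeriodicDelta

/-! ### Assembly -/

theorem mainTheorem3 (g : ℝ) (hg : 0 < g) :
    ∃ β C : ℝ,
      -- the quantization condition
      (β ∈ Set.Ioo 0 (2 * Real.pi) ∧ β * Real.tan (β / 2) = g / 2 ∧
        ∀ β' ∈ Set.Ioo 0 (2 * Real.pi), β' * Real.tan (β' / 2) = g / 2 → β' = β) ∧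
      -- the ground state
      0 < C ∧ ‖evenState g β C‖ = 1 ∧
      IsGroundState (deltaHamiltonian g) (β ^ 2)
        (evenState g β C) ∧
      (∀ f, IsEigenvector (deltaHamiltonian g) (β ^ 2) f →
        ∃ c : ℂ, f = c • evenState g β C) ∧
      -- the odd eigenfunctions
      (∀ j : ℕ, 1 ≤ j → ‖oddState j‖ = 1 ∧
        IsOdd (oddState j) ∧
        IsEigenvector (deltaHamiltonian g)
          (4 * Real.pi ^ 2 * (j : ℝ) ^ 2) (oddState j)) ∧
      (∀ (E : ℝ) (f : L2), IsOdd f →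
        IsEigenvector (deltaHamiltonian g) E f →
        ∃ j : ℕ, 1 ≤ j ∧ E = 4 * Real.pi ^ 2 * (j : ℝ) ^ 2 ∧
          ∃ c : ℂ, f = c • oddState j) ∧
      -- the momentum matrix elements
      (∀ j : ℕ, oddState j ∈ momentum.domain) ∧
      ((fun j : ℕ =>
          inner ℂ (app momentum (oddState j))
              (evenState g β C)
            - (-(Complex.I * C * g / (√2 * j * Real.pi))))
        =O[Filter.atTop] fun j : ℕ => 1 / (j : ℝ) ^ 3) ∧
      -- the unitary group generated by the Hamiltonian and the commutator
      (∃ U : ℝ → (L2 ≃ₗᵢ[ℂ] L2),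
        IsUnitaryGroupOf (deltaHamiltonian g) U ∧
        (∀ U', IsUnitaryGroupOf (deltaHamiltonian g) U' → U' = U) ∧
        (∀ t, U t (evenState g β C) ∈ momentum.domain) ∧
        (∃ (K : ℝ) (F : ℝ → ℝ), K ≠ 0 ∧ DifferentiableAt ℝ F 0 ∧
          ∀ t, commutatorExpectation momentum U
            (evenState g β C) t
              = ((K * riemannFunction t + F t : ℝ) : ℂ)) ∧
        ¬ DifferentiableAt ℝ riemannFunction 0 ∧
        ¬ DifferentiableAt ℝ (commutatorExpectation momentum U
            (evenState g β C)) 0 ∧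
        ∀ α ∈ Set.Ico (0 : ℝ) (1 / 2), ∃ M : ℝ, ∀ t,
          ‖commutatorExpectation momentum U
              (evenState g β C) t
            - commutatorExpectation momentum U
              (evenState g β C) 0‖ ≤ M * |t| ^ α) ∧
      -- the failure of the sum rule
      (∃ (b : HilbertBasis ℕ ℂ L2) (E : ℕ → ℝ),
        ∀ n, IsEigenvector (deltaHamiltonian g) (E n) (b n)) ∧
      (∀ (b : HilbertBasis ℕ ℂ L2) (E : ℕ → ℝ),
        (∀ n, IsEigenvector (deltaHamiltonian g) (E n) (b n)) →
        ∀ S : ℝ, ¬ HasSum (fun n => 2 * ‖inner ℂ (b n)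
            (app momentum (evenState g β C))‖ ^ 2
              * (E n - β ^ 2)) S) := by
  obtain ⟨β, hβ, hq, huniq⟩ := exists_unique_quantization hg
  obtain ⟨C, hC, hnorm⟩ := exists_norm_evenState hβ hq
  have hne : evenState g β C ≠ 0 := by
    rw [← norm_pos_iff, hnorm]
    exact one_pos
  have hgraph := evenState_mem_deltaGraph C hβ hq
  obtain ⟨P, hP, hPodd, hPj⟩ := exists_momentum_evenState C hβ hq
  obtain ⟨U, hU⟩ := exists_isUnitaryGroupOf hg
  have hdom : ∀ f w, (f, w) ∈ momentumGraph → f ∈ momentum.domain := fun f w h => by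
    rw [← momentum_graph] at h
    exact LinearPMap.mem_domain_of_mem_graph h
  have hnormPj : ∀ j : ℕ, ‖inner ℂ (oddState (j + 1)) P‖ ^ 2 = 2 * (g * C) ^ 2 *
      (oddEnergy (j + 1) / (oddEnergy (j + 1) - β ^ 2) ^ 2) := fun j => by
    rw [hPj, norm_neg, norm_mul, Complex.norm_I, one_mul, Complex.norm_real, Real.norm_eq_abs,
      sq_abs, sq_matrixElement]
  set m : ℕ → ℝ := fun j =>
    2 * (g * C) ^ 2 * (oddEnergy (j + 1) / (oddEnergy (j + 1) - β ^ 2) ^ 2) with hm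
  have hCE : ∀ t, commutatorExpectation momentum U (evenState g β C) t
      = ((∑' j, -2 * m j * Real.sin ((oddEnergy (j + 1) - β ^ 2) * t) : ℝ) : ℂ) := fun t => by
    obtain ⟨r, hr, hsum⟩ := hasSum_commutatorExpectation hU hgraph hP
      (fun j : ℕ => oddState_mem_deltaGraph g (j + 1)) (hasSum_oddState hPodd) t
    simp only [hnormPj] at hsum
    rw [hr, ← hsum.tsum_eq]
  obtain ⟨F, hF, hKF⟩ := exists_differentiableAt_remainder (ω := β ^ 2)
    (fun j => (matrixElement_bounds g C hβ j).1) fun j => (matrixElement_bounds g C hβ j).2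
  set K : ℝ := -2 * ((g * C) ^ 2 / (2 * Real.pi ^ 2)) with hK
  have hK0 : K ≠ 0 := by
    have : 0 < (g * C) ^ 2 / (2 * Real.pi ^ 2) := by positivity
    exact ne_of_lt (by simp only [hK]; linarith)
  have hCE' : ∀ t, commutatorExpectation momentum U (evenState g β C) t
      = ((K * riemannFunction t + F t : ℝ) : ℂ) := fun t => by rw [hCE, hKF]
  have hnd : ¬ DifferentiableAt ℝ (commutatorExpectation momentum U (evenState g β C)) 0 := by
    intro hd
    have h1 : DifferentiableAt ℝ (fun t => K * riemannFunction t + F t) 0 := by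
      have h2 := (Complex.reCLM.differentiableAt.comp (0 : ℝ) hd :)
      refine h2.congr_of_eventuallyEq (Filter.Eventually.of_forall fun t => ?_)
      simp only [Function.comp_apply, hCE', Complex.reCLM_apply, Complex.ofReal_re]
    have h2 := (h1.sub hF).const_mul K⁻¹
    refine not_differentiableAt_riemannFunction
      (h2.congr_of_eventuallyEq (Filter.Eventually.of_forall fun t => ?_))
    simp only [Pi.sub_apply]
    field_simp
    ring
  refine ⟨β, C, ⟨⟨hβ.1, by linarith [hβ.2, Real.pi_pos]⟩, hq, huniq⟩, hC, hnorm,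
    isGroundState_evenState hg hβ hq hne, ?_, ?_, ?_, ?_, ?_, ?_, ?_, ?_⟩
  · rintro f ⟨-, hf⟩
    rw [deltaHamiltonian_graph] at hf
    exact eq_smul_evenState hg hC hβ hq hf
  · intro j hj
    obtain ⟨i, rfl⟩ := Nat.exists_eq_add_of_le' hj
    have h1 := orthonormal_oddState.1 i
    refine ⟨h1, isOdd_oddState _, orthonormal_oddState.ne_zero i, ?_⟩
    rw [deltaHamiltonian_graph]
    exact oddState_mem_deltaGraph g (i + 1)
  · rintro E f hodd ⟨h0, hf⟩
    rw [deltaHamiltonian_graph] at hf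
    exact exists_eq_smul_oddState hodd h0 hf
  · exact fun j => hdom _ _ (oddState_mem_momentumGraph j)
  · simp only [app_momentum_oddState_inner hP, hPj]
    exact isBigO_matrixElement hg hC hβ
  · refine ⟨U, hU, fun U' hU' => hU.unique hg hU', fun t => ?_, ⟨K, F, hK0, hF, hCE'⟩,
      not_differentiableAt_riemannFunction, hnd, fun α hα => ?_⟩
    · rw [hU.apply_eigenvector (by rw [deltaHamiltonian_graph]; exact hgraph)]
      exact hdom _ _ (momentumGraph.smul_mem _ hP)
    · obtain ⟨M, hM⟩ := exists_holder_bound (sq_nonneg β)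
        (by nlinarith [hβ.1, hβ.2, Real.pi_pos])
        (fun j => (matrixElement_bounds g C hβ j).1) hα.1 hα.2
      refine ⟨M, fun t => ?_⟩
      have h0 : commutatorExpectation momentum U (evenState g β C) 0 = 0 := by
        rw [hCE]
        simp
      rw [h0, sub_zero, hCE, Complex.norm_real, Real.norm_eq_abs]
      exact hM t
  · obtain ⟨b, E, hb⟩ := exists_hilbertBasis_deltaGraph hg
    refine ⟨b, E, fun n => ⟨b.orthonormal.ne_zero n, ?_⟩⟩
    rw [deltaHamiltonian_graph]
    exact hb n
  · intro b E hb S hS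
    have hb' : ∀ n, (b n, (E n : ℂ) • b n) ∈ deltaGraph g := fun n => by
      rw [← deltaHamiltonian_graph]
      exact (hb n).2
    rw [app_momentum hP] at hS
    have hrepr : HasSum (fun n => inner ℂ (b n) P • b n) P := by
      simpa only [b.repr_apply_apply] using b.hasSum_repr P
    -- The terms of the sum rule are, up to sign, the derivatives at `0` of the commutator's sine
    -- series in the basis `b`; their summability contradicts `hnd`.
    have hd := differentiable_tsum_sin (m := fun n => -2 * ‖inner ℂ (b n) P‖ ^ 2)
      (E := fun n => E n - β ^ 2) (hS.summable.neg.congr fun n => by ring)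
    refine hnd (((Complex.ofRealCLM.differentiableAt.comp (0 : ℝ) (hd 0) :)).congr_of_eventuallyEq
      (Filter.Eventually.of_forall fun t => ?_))
    obtain ⟨r, hr, hsum⟩ := hasSum_commutatorExpectation hU hgraph hP hb' hrepr t
    rw [hr, ← hsum.tsum_eq]
    rfl
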